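/- **Uniform consistency of the boundary-corrected smoothed Grenander density estimator under random censoring.** *Model.* Let $(X_i,C_i)_{i\ge 1}$ be i.i.d. pairs of real random variables with $X_i$ independent of $C_i$. The survival times $X_i\ge 0$ have distribution function $F$ and density $f$ (with $f\ge 0$, and $f=0$ on $(-\infty,0)$), and the censoring times $C_i$ have distribution function $G$ and density $g$. One observes $T_i=\min(X_i,C_i)$ and $\Delta_i=\mathbf 1_{\{X_i\le C_i\}}$ for $i\le n$. Let $H$ be the distribution function of $T_1$, let $\tau_F,\tau_G,\tau_H$ be the right end points of the supports of $F,G,H$ (e.g. $\tau_F=\sup\{x:F(x)<1\}$), and assume $\tau_H=\tau_G<\tau_F\le\infty$. *Estimator.* Let $F_n$ be the Kaplan–Meier estimator based on $(T_i,\Delta_i)_{i\le n}$, $$F_n(t)=1-\prod_{u\in\{T_1,\dots,T_n\},\ u\le t}\Bigl(1-\frac{\#\{j:T_j=u,\ \Delta_j=1\}}{\#\{j:T_j\ge u\}}\Bigr),$$ let $\tilde F_n$ be the greatest convex minorant of $F_n$ on $[0,\tau_H]$, and let $\tilde f_n$ be the left-hand slope of $\tilde F_n$. Let $k$ be a symmetric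 probability density on $\mathbb R$ with support in $[-1,1]$. For $s\in[0,1]$ let $\phi(s),\psi(s)$ be the solution of $$\phi(s)\int_{-1}^s k(u)\,du+\psi(s)\int_{-1}^s uk(u)\,du=1,\qquad \phi(s)\int_{-1}^s uk(u)\,du+\psi(s)\int_{-1}^s u^2k(u)\,du=0 .$$ For a bandwidth $b=b_n$ and $x\in[0,\tau_H]$ put $$k^{(x)}(u)=\begin{cases}\phi(\frac xb)k(u)+\psi(\frac xb)\,uk(u), & x\in[0,b],\\ k(u), & x\in(b,\tau_H-b),\\ \phi(\frac{\tau_H-x}b)k(u)-\psi(\frac{\tau_H-x}b)\,uk(u), & x\in[\tau_H-b,\tau_H],\end{cases}$$ $$\hat f_n^{SG}(x)=\int_{(x-b)\vee 0}^{(x+b)\wedge\tau_H}\frac1b\,k^{(x)}\!\Bigl(\frac{x-u}b\Bigr)\tilde f_n(u)\,du .$$ *Theorem.* Suppose that $f$ is nondecreasing and uniformly continuous on $[0,\tau_H)$, that $k$ is differentiable on $\mathbb R$ with bounded derivative, and that $b_n n^{\alpha}\to c\in(0,\infty)$ with $0<\alpha<1/2$. Then, for every $0<M<\tau_H$, $$\sup_{x\in[0,M]}\bigl|\hat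 f_n^{SG}(x)-f(x)\bigr|\to 0\quad\text{in probability as } n\to\infty .$$ -/

import Mathlib

open MeasureTheory ProbabilityTheory Filter Topology Set

noncomputable section

namespace SmoothedGrenander

/-- The right end point `sup {x : μ((-∞, x]) < 1}` of the support of a probability law `μ` on `ℝ`,
as an extended real number. -/
def rightEndpoint (μ : Measure ℝ) : EReal :=
  sSup ((fun x : ℝ => (x : EReal)) '' {x : ℝ | cdf μ x < 1})

/-- The follow-up time `T = min(X, C)`. -/
def followUp (x c : ℝ) : ℝ := min x c

/-- The censoring indicator `Δ = 1_{X ≤ C}`. -/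
def censInd (x c : ℝ) : ℕ := if x ≤ c then 1 else 0

/-- Number of individuals at risk at time `u`: `#{j : T_j ≥ u}`. -/
def atRisk {n : ℕ} (T : Fin n → ℝ) (u : ℝ) : ℕ :=
  (Finset.univ.filter fun j => u ≤ T j).card

/-- Number of observed (uncensored) events at time `u`: `#{j : T_j = u, Δ_j = 1}`. -/
def eventsAt {n : ℕ} (T : Fin n → ℝ) (Δ : Fin n → ℕ) (u : ℝ) : ℕ :=
  (Finset.univ.filter fun j => T j = u ∧ Δ j = 1).card

/-- The Kaplan–Meier (product-limit) estimator of the distribution function, the product running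
over the distinct follow-up times `u ≤ t`. -/
def kaplanMeier {n : ℕ} (T : Fin n → ℝ) (Δ : Fin n → ℕ) (t : ℝ) : ℝ :=
  1 - ∏ u ∈ (Finset.univ.image T).filter (fun u => u ≤ t),
    (1 - (eventsAt T Δ u : ℝ) / (atRisk T u : ℝ))

/-- The greatest convex minorant on the set `S` of a function `h` (for `h` bounded below on `S`
and `x ∈ S`): the pointwise supremum of all convex functions on `S` lying below `h` on `S`. -/
def gcm (S : Set ℝ) (h : ℝ → ℝ) (x : ℝ) : ℝ :=
  sSup {y | ∃ g : ℝ → ℝ, ConvexOn ℝ S g ∧ (∀ t ∈ S, g t ≤ h t) ∧ g x = y}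

/-- The Grenander-type estimator of an increasing density: the left-hand slope of the greatest
convex minorant on `[0, τ]` of the Kaplan–Meier estimator. -/
def grenander {n : ℕ} (τ : ℝ) (T : Fin n → ℝ) (Δ : Fin n → ℕ) (t : ℝ) : ℝ :=
  derivWithin (gcm (Icc 0 τ) (kaplanMeier T Δ)) (Iio t) t

/-- `k` is a symmetric probability density on `ℝ` with support in `[-1, 1]`. -/
structure IsStandardKernel (k : ℝ → ℝ) : Prop where
  nonneg : ∀ u, 0 ≤ k u
  symm : ∀ u, k (-u) = k u
  support_subset : Function.support k ⊆ Icc (-1) 1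
  integrable : Integrable k
  integral_eq_one : ∫ u, k u = 1

/-- The truncated moment `∫_{-1}^s u^j k(u) du`. -/
def truncMoment (k : ℝ → ℝ) (j : ℕ) (s : ℝ) : ℝ := ∫ u in (-1)..s, u ^ j * k u

/-- Determinant of the linear system defining the boundary coefficients. -/
def boundaryDet (k : ℝ → ℝ) (s : ℝ) : ℝ :=
  truncMoment k 0 s * truncMoment k 2 s - truncMoment k 1 s ^ 2

/-- The boundary coefficient `φ(s)`, solving (with `ψ(s)`) the system of `boundaryCoeff_spec`. -/
def phi (k : ℝ → ℝ) (s : ℝ) : ℝ := truncMoment k 2 s / boundaryDet k s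

/-- The boundary coefficient `ψ(s)`, solving (with `φ(s)`) the system of `boundaryCoeff_spec`. -/
def psi (k : ℝ → ℝ) (s : ℝ) : ℝ := -truncMoment k 1 s / boundaryDet k s

/-- `φ(s)` and `ψ(s)` are the unique solution of the defining linear system, whenever it is
nonsingular. -/
theorem boundaryCoeff_spec (k : ℝ → ℝ) (s : ℝ) (h : boundaryDet k s ≠ 0) (p q : ℝ) :
    ((p * ∫ u in (-1)..s, k u) + (q * ∫ u in (-1)..s, u * k u) = 1 ∧
      (p * ∫ u in (-1)..s, u * k u) + (q * ∫ u in (-1)..s, u ^ 2 * k u) = 0) ↔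
    p = phi k s ∧ q = psi k s := by
  have h0 : truncMoment k 0 s = ∫ u in (-1)..s, k u := by simp [truncMoment]
  have h1 : truncMoment k 1 s = ∫ u in (-1)..s, u * k u := by simp [truncMoment]
  have h2 : truncMoment k 2 s = ∫ u in (-1)..s, u ^ 2 * k u := rfl
  rw [← h0, ← h1, ← h2, phi, psi, eq_div_iff h, eq_div_iff h]
  constructor
  · rintro ⟨e1, e2⟩
    unfold boundaryDet
    constructor
    · linear_combination truncMoment k 2 s * e1 - truncMoment k 1 s * e2
    · linear_combination truncMoment k 0 s * e2 - truncMoment k 1 s * e1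
  · rintro ⟨e1, e2⟩
    constructor
    · apply mul_right_cancel₀ h
      unfold boundaryDet at *
      linear_combination truncMoment k 0 s * e1 + truncMoment k 1 s * e2
    · apply mul_right_cancel₀ h
      unfold boundaryDet at *
      linear_combination truncMoment k 1 s * e1 + truncMoment k 2 s * e2

/-- The boundary kernel `k^{(x)}` on `[0, τ]` with bandwidth `b`. -/
def boundaryKernel (k : ℝ → ℝ) (τ b x u : ℝ) : ℝ :=
  if x ≤ b then phi k (x / b) * k u + psi k (x / b) * (u * k u)
  else if x < τ - b then k u
  else phi k ((τ - x) / b) * k u - psi k ((τ - x) / b) * (u * k u)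

/-- The boundary-corrected smoothed Grenander-type estimator of the density,
`f̂(x) = ∫_{(x-b) ∨ 0}^{(x+b) ∧ τ} b⁻¹ k^{(x)}((x-u)/b) f̃(u) du`. -/
def smoothedGrenander {n : ℕ} (k : ℝ → ℝ) (τ b : ℝ) (T : Fin n → ℝ) (Δ : Fin n → ℕ)
    (x : ℝ) : ℝ :=
  ∫ u in (max (x - b) 0)..(min (x + b) τ),
    b⁻¹ * boundaryKernel k τ b x ((x - u) / b) * grenander τ T Δ u

end SmoothedGrenander

end

/-!
The proof compares slopes of convex functions, after establishing how fast the Kaplan–Meier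
estimator `F_n` converges to `F`, where `F t = ∫₀ᵗ f`.

*Rate for `F_n`.* Fix `M' < τ`, so that `P (T ≥ M') > 0`. The at-risk fraction and the average of
`Δ_i 1{T_i ≤ t} / H (T_i)`, where `H t = P (T ≥ t)`, are averages of independent bounded processes,
monotone in `t`, with continuous means `H t` and `-log (1 - F t)`. Hoeffding's inequality on a grid with
equal mean increments gives uniform closeness at every rate `n ^ (-α)` with `α < 1/2`
(`tendsto_measure_uniform_deviation`). A deterministic stability estimate for the product-limit
formula (`abs_kaplanMeier_sub_le`) transfers this to `F_n`, so that, for every `θ > 0`,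
`|F_n - F| ≤ θ b_n` on `[0, M']` with probability tending to one
(`tendsto_measure_kaplanMeier_deviation`).

*Slopes.* On `[M', τ]` nothing is known about `F_n` except monotonicity; but if `F τ - F M'` is
small, this already yields a small lower deviation on all of `[0, τ]`. As `F` is convex, the
greatest convex minorant of `F_n` inherits these bounds, and comparing secants over a fixed length
shows that its left-hand slope is close to `f` away from the origin, and not much above `f` near
it. For the lower bound near the origin, a line of slope slightly below `f 0` and intercept
`-θ b_n` is a minorant of `F_n`; it shows that the slope is close to `f 0` beyond a small multiple
`γ b_n` of the bandwidth (`leftDeriv_gcm_bounds`). This is where `b_n` must dominate `n ^ (-1/2)`.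

*Smoothing.* The truncated moments satisfy a strict Cauchy–Schwarz inequality, so the boundary
kernels are bounded uniformly in `x ∈ [0, M]`; they have total mass one. Hence the smoothed slope
differs from `f x` by a multiple of the slope error beyond `γ b_n` plus a multiple of `γ`
(`abs_kernel_average_sub_le`).
-/

namespace SmoothedGrenander

/-! ### Stability of the product-limit estimator -/

theorem abs_prod_sub_prod_le {ι : Type*} (s : Finset ι) (a b : ι → ℝ)
    (ha : ∀ i ∈ s, |a i| ≤ 1) (hb : ∀ i ∈ s, |b i| ≤ 1) :
    |∏ i ∈ s, a i - ∏ i ∈ s, b i| ≤ ∑ i ∈ s, |a i - b i| := by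
  classical
  induction s using Finset.induction_on with
  | empty => simp
  | insert j s hj ih =>
    have ih' := ih (fun i hi => ha i (Finset.mem_insert_of_mem hi))
      (fun i hi => hb i (Finset.mem_insert_of_mem hi))
    rw [Finset.prod_insert hj, Finset.prod_insert hj, Finset.sum_insert hj]
    have h1 : |∏ i ∈ s, b i| ≤ 1 := by
      rw [Finset.abs_prod]
      exact Finset.prod_le_one (fun i _ => abs_nonneg _)
        (fun i hi => hb i (Finset.mem_insert_of_mem hi))
    have h2 := ha j (Finset.mem_insert_self j s)
    calc |a j * ∏ i ∈ s, a i - b j * ∏ i ∈ s, b i|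
        = |a j * (∏ i ∈ s, a i - ∏ i ∈ s, b i) + (a j - b j) * ∏ i ∈ s, b i| := by ring_nf
      _ ≤ |a j| * |∏ i ∈ s, a i - ∏ i ∈ s, b i| + |a j - b j| * |∏ i ∈ s, b i| := by
        rw [← abs_mul, ← abs_mul]; exact abs_add_le _ _
      _ ≤ 1 * |∏ i ∈ s, a i - ∏ i ∈ s, b i| + |a j - b j| * 1 := by gcongr
      _ ≤ _ := by linarith

/-- A product of factors `1 - x i` differs from `exp (-∑ x i)` by at most `∑ (x i)²`. -/
theorem abs_prod_one_sub_sub_exp_le {ι : Type*} (s : Finset ι) (x : ι → ℝ)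
    (hx : ∀ i ∈ s, x i ∈ Icc (0 : ℝ) 1) :
    |∏ i ∈ s, (1 - x i) - Real.exp (-∑ i ∈ s, x i)| ≤ ∑ i ∈ s, x i ^ 2 := by
  rw [← Finset.sum_neg_distrib, Real.exp_sum]
  refine (abs_prod_sub_prod_le s _ _ ?_ ?_).trans (Finset.sum_le_sum fun i hi => ?_)
  · intro i hi
    have := hx i hi
    rw [abs_le]; constructor <;> linarith [this.1, this.2]
  · intro i hi
    rw [abs_of_pos (Real.exp_pos _), Real.exp_le_one_iff]
    linarith [(hx i hi).1]
  · have h := Real.abs_exp_sub_one_sub_id_le (x := -x i)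
      (by rw [abs_neg, abs_of_nonneg (hx i hi).1]; exact (hx i hi).2)
    rw [abs_sub_comm]
    calc |Real.exp (-x i) - (1 - x i)| = |Real.exp (-x i) - 1 - -x i| := by ring_nf
      _ ≤ (-x i) ^ 2 := h
      _ = x i ^ 2 := by ring

theorem abs_exp_neg_sub_exp_neg_le {a b : ℝ} (ha : 0 ≤ a) (hb : 0 ≤ b) :
    |Real.exp (-a) - Real.exp (-b)| ≤ |a - b| := by
  wlog hab : a ≤ b generalizing a b
  · rw [abs_sub_comm, abs_sub_comm a]; exact this hb ha (le_of_not_ge hab)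
  have h1 : Real.exp (-b) ≤ Real.exp (-a) := Real.exp_le_exp.2 (by linarith)
  rw [abs_of_nonneg (by linarith), abs_sub_comm, abs_of_nonneg (by linarith)]
  have h2 : Real.exp (-b) = Real.exp (-a) * Real.exp (-(b - a)) := by
    rw [← Real.exp_add]; ring_nf
  have h3 := Real.add_one_le_exp (-(b - a))
  have h4 : Real.exp (-a) ≤ 1 := Real.exp_le_one_iff.2 (by linarith)
  have h5 := Real.exp_pos (-a)
  rw [h2]
  nlinarith

section ProductLimit

variable {n : ℕ} (T : Fin n → ℝ) (Δ : Fin n → ℕ)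

theorem eventsAt_le_atRisk (u : ℝ) : eventsAt T Δ u ≤ atRisk T u := by
  refine Finset.card_le_card fun j hj => ?_
  simp only [Finset.mem_filter, Finset.mem_univ, true_and] at hj ⊢
  exact hj.1.ge

theorem eventsAt_div_atRisk_mem_Icc (u : ℝ) :
    (eventsAt T Δ u : ℝ) / atRisk T u ∈ Icc (0 : ℝ) 1 :=
  ⟨by positivity, div_le_one_of_le₀ (by exact_mod_cast eventsAt_le_atRisk T Δ u) (by positivity)⟩

theorem kaplanMeier_monotone : Monotone (kaplanMeier T Δ) := by
  intro s t hst
  unfold kaplanMeier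
  have hsub : (Finset.univ.image T).filter (fun u => u ≤ s) ⊆
      (Finset.univ.image T).filter (fun u => u ≤ t) :=
    Finset.monotone_filter_right _ fun u _ (hu : u ≤ s) => hu.trans hst
  rw [← Finset.prod_sdiff hsub]
  refine sub_le_sub_left (mul_le_of_le_one_left (Finset.prod_nonneg fun u _ => ?_)
    (Finset.prod_le_one (fun u _ => ?_) fun u _ => ?_)) _
  all_goals linarith [(eventsAt_div_atRisk_mem_Icc T Δ u).1, (eventsAt_div_atRisk_mem_Icc T Δ u).2]

/-- A weighted sum over distinct event times, rewritten as a sum over individuals. -/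
theorem sum_eventsAt_mul (w : ℝ → ℝ) (t : ℝ) :
    ∑ u ∈ (Finset.univ.image T).filter (fun u => u ≤ t), (eventsAt T Δ u : ℝ) * w u
      = ∑ i, if Δ i = 1 ∧ T i ≤ t then w (T i) else 0 := by
  have h1 : ∀ u, (eventsAt T Δ u : ℝ) * w u
      = ∑ i, if u = T i then (if Δ i = 1 then w (T i) else 0) else 0 := by
    intro u
    rw [eventsAt, Finset.card_filter, Nat.cast_sum, Finset.sum_mul]
    refine Finset.sum_congr rfl fun i _ => ?_
    by_cases h : u = T i
    · subst h; by_cases h' : Δ i = 1 <;> simp [h']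
    · simp [h, Ne.symm h]
  simp_rw [h1]
  rw [Finset.sum_comm]
  refine Finset.sum_congr rfl fun i _ => ?_
  rw [Finset.sum_ite_eq']
  by_cases h : T i ≤ t <;> by_cases h' : Δ i = 1 <;> simp [h, h']

/-- Stability of the product-limit estimator. Suppose that on `[0, M]` the fraction at risk is
within `ρ` of a function `Hb ≥ p`, and the inversely weighted event average is within `ρ` of a
continuous cumulative hazard `A`. Then the Kaplan–Meier estimator is within a multiple of `ρ` of
`1 - exp (-A)`. Ties need no exclusion: continuity of `A` bounds every jump by `2 ρ`. -/
theorem abs_kaplanMeier_sub_le (hn : 0 < n) {M ρ p : ℝ} {Hb A : ℝ → ℝ} (hp : 0 < p)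
    (hρp : ρ ≤ p / 2) (hΔ : ∀ i, Δ i = 1 → 0 ≤ T i)
    (hHp : ∀ s ∈ Icc 0 M, p ≤ Hb s) (hH1 : ∀ s ∈ Icc 0 M, Hb s ≤ 1)
    (hA0 : A 0 = 0) (hA_nonneg : ∀ t ∈ Icc 0 M, 0 ≤ A t) (hAc : ContinuousOn A (Icc 0 M))
    (hrisk : ∀ s ∈ Icc 0 M, |(atRisk T s : ℝ) / n - Hb s| ≤ ρ)
    (hW : ∀ t ∈ Icc 0 M,
      |(∑ i, if Δ i = 1 ∧ T i ≤ t then (Hb (T i))⁻¹ else 0) / n - A t| ≤ ρ)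
    {t : ℝ} (ht : t ∈ Icc 0 M) :
    |kaplanMeier T Δ t - (1 - Real.exp (-A t))| ≤ (1 + 10 / p ^ 2) * ρ := by
  have hn' : (0 : ℝ) < n := by exact_mod_cast hn
  have hρ : 0 ≤ ρ := (abs_nonneg _).trans (hrisk t ht)
  have hp1 : p ≤ 1 := (hHp t ht).trans (hH1 t ht)
  set W : ℝ → ℝ := fun t => ∑ i, if Δ i = 1 ∧ T i ≤ t then (Hb (T i))⁻¹ else 0 with hWdef
  set I := (Finset.univ.image T).filter (fun u => u ≤ t) with hI
  set x : ℝ → ℝ := fun u => (eventsAt T Δ u : ℝ) / atRisk T u with hx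
  have hr : ∀ s ∈ Icc 0 M, p / 2 * n ≤ atRisk T s := by
    intro s hs
    rw [← le_div_iff₀ hn']
    linarith [(abs_le.1 (hrisk s hs)).1, hHp s hs]
  have hev : ∀ u ∈ I, eventsAt T Δ u ≠ 0 → u ∈ Icc 0 M := by
    intro u hu h0
    obtain ⟨j, hj⟩ := Finset.card_ne_zero.1 h0
    simp only [Finset.mem_filter, Finset.mem_univ, true_and] at hj
    exact ⟨hj.1 ▸ hΔ j hj.2, (Finset.mem_filter.1 hu).2.trans ht.2⟩
  -- the total mass which the weighted event average puts on `u`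
  have hjumpW : ∀ s u : ℝ, s < u → (eventsAt T Δ u : ℝ) * (Hb u)⁻¹ ≤ W u - W s ∨ u ∉ Icc 0 M := by
    intro s u hsu
    by_cases hu : u ∈ Icc 0 M
    swap; · exact Or.inr hu
    left
    rw [eventsAt, Finset.card_filter, Nat.cast_sum, Finset.sum_mul, hWdef]
    simp only
    rw [← Finset.sum_sub_distrib]
    refine Finset.sum_le_sum fun i _ => ?_
    by_cases h1 : Δ i = 1
    · by_cases h2 : T i = u
      · simp [h1, h2, hsu.not_ge]
      · by_cases h3 : T i ≤ u
        · have : 0 ≤ (Hb (T i))⁻¹ :=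
            inv_nonneg.2 (hp.le.trans (hHp _ ⟨hΔ i h1, h3.trans hu.2⟩))
          by_cases h4 : T i ≤ s <;> simp [h1, h2, h3, h4, this]
        · have h4 : ¬ T i ≤ s := fun h => h3 (h.trans hsu.le)
          simp [h1, h2, h3, h4]
    · simp [h1]
  have hjump : ∀ u ∈ Icc 0 M, (eventsAt T Δ u : ℝ) * (Hb u)⁻¹ ≤ 2 * ρ * n := by
    intro u hu
    rcases hu.1.eq_or_lt with h0 | h0
    · have h1 : (eventsAt T Δ u : ℝ) * (Hb u)⁻¹ ≤ W u := by
        have hW0 : W (-1) = 0 := by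
          refine Finset.sum_eq_zero fun i _ => ?_
          rw [if_neg]
          rintro ⟨h1, h2⟩
          linarith [hΔ i h1]
        rcases hjumpW (-1) u (by linarith) with h | h
        · rwa [hW0, sub_zero] at h
        · exact absurd hu h
      have h2 := (abs_le.1 (hW u hu)).2
      rw [← h0, hA0, sub_zero, div_le_iff₀ hn'] at h2
      rw [← h0] at h1 ⊢
      exact h1.trans (h2.trans (by nlinarith))
    · have hlim : Tendsto (fun s => (A u - A s + 2 * ρ) * n) (𝓝[Ico 0 u] u)
          (𝓝 ((A u - A u + 2 * ρ) * n)) := by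
        have : Tendsto A (𝓝[Ico 0 u] u) (𝓝 (A u)) :=
          (hAc u hu).mono fun s hs => ⟨hs.1, hs.2.le.trans hu.2⟩
        exact ((this.const_sub _).add_const _).mul_const _
      have : (𝓝[Ico 0 u] u).NeBot := right_nhdsWithin_Ico_neBot h0
      rw [sub_self, zero_add] at hlim
      refine ge_of_tendsto hlim ?_
      filter_upwards [self_mem_nhdsWithin] with s hs
      rcases hjumpW s u hs.2 with h | h
      · refine h.trans ?_
        have h1 := (abs_le.1 (hW u hu)).2
        have h2 := (abs_le.1 (hW s ⟨hs.1, hs.2.le.trans hu.2⟩)).1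
        have h3 : (W u - W s) / n ≤ A u - A s + 2 * ρ := by
          rw [sub_div]; linarith
        rwa [div_le_iff₀ hn'] at h3
      · exact absurd hu h
  have hxI : ∀ u, x u ∈ Icc (0 : ℝ) 1 := eventsAt_div_atRisk_mem_Icc T Δ
  have hxle : ∀ u ∈ I, x u ≤ 4 * ρ / p := by
    intro u hu
    by_cases h0 : eventsAt T Δ u = 0
    · simp only [hx, h0, Nat.cast_zero, zero_div]; positivity
    have hu' := hev u hu h0
    have h1 := hjump u hu'
    have hHu : 0 < Hb u := hp.trans_le (hHp u hu')
    rw [← div_eq_mul_inv, div_le_iff₀ hHu] at h1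
    have h2 : (eventsAt T Δ u : ℝ) ≤ 2 * ρ * n :=
      h1.trans (mul_le_of_le_one_right (by positivity) (hH1 u hu'))
    have h3 := hr u hu'
    calc x u ≤ 2 * ρ * n / (p / 2 * n) := by
          simp only [hx]; gcongr
      _ = 4 * ρ / p := by field_simp; ring
  -- the Nelson–Aalen sum, rewritten as a sum over individuals
  have hΛ : ∑ u ∈ I, x u = ∑ i, if Δ i = 1 ∧ T i ≤ t then ((atRisk T (T i) : ℝ))⁻¹ else 0 := by
    rw [← sum_eventsAt_mul T Δ (fun u => ((atRisk T u : ℝ))⁻¹) t]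
    exact Finset.sum_congr rfl fun u _ => div_eq_mul_inv _ _
  have hterm : ∀ i, Δ i = 1 ∧ T i ≤ t → T i ∈ Icc 0 M := fun i hi =>
    ⟨hΔ i hi.1, hi.2.trans ht.2⟩
  have hΛle : ∑ u ∈ I, x u ≤ 2 / p := by
    rw [hΛ]
    calc _ ≤ ∑ _i : Fin n, 2 / (p * n) := by
          refine Finset.sum_le_sum fun i _ => ?_
          split_ifs with h
          · have := hr _ (hterm i h)
            calc ((atRisk T (T i) : ℝ))⁻¹ ≤ (p / 2 * n)⁻¹ := by gcongr
              _ = 2 / (p * n) := by field_simp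
          · positivity
      _ = 2 / p := by simp; field_simp
  have hΛA : |∑ u ∈ I, x u - A t| ≤ 2 / p ^ 2 * ρ + ρ := by
    have h1 : |∑ u ∈ I, x u - W t / n| ≤ 2 / p ^ 2 * ρ := by
      rw [hΛ, hWdef, Finset.sum_div, ← Finset.sum_sub_distrib]
      refine (Finset.abs_sum_le_sum_abs _ _).trans ?_
      calc _ ≤ ∑ _i : Fin n, 2 / p ^ 2 * ρ / n := by
            refine Finset.sum_le_sum fun i _ => ?_
            split_ifs with h
            · have hi := hterm i h
              have h2 := hr _ hi
              have h3 := hHp _ hi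
              have h4 := hrisk _ hi
              have hr0 : (0 : ℝ) < atRisk T (T i) := lt_of_lt_of_le (by positivity) h2
              have hH0 : 0 < Hb (T i) := hp.trans_le h3
              have e : ((atRisk T (T i) : ℝ))⁻¹ - (Hb (T i))⁻¹ / n
                  = -((atRisk T (T i) : ℝ) / n - Hb (T i)) / (atRisk T (T i) * Hb (T i)) := by
                field_simp; ring
              rw [e, abs_div, abs_neg, abs_of_pos (mul_pos hr0 hH0)]
              calc _ ≤ ρ / ((p / 2 * n) * p) := by gcongr
                _ = 2 / p ^ 2 * ρ / n := by field_simp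
            · simp; positivity
        _ = 2 / p ^ 2 * ρ := by simp; field_simp
    have h2 := hW t ht
    calc |∑ u ∈ I, x u - A t| = |(∑ u ∈ I, x u - W t / n) + (W t / n - A t)| := by ring_nf
      _ ≤ _ := (abs_add_le _ _).trans (add_le_add h1 h2)
  have hsq : ∑ u ∈ I, x u ^ 2 ≤ 8 / p ^ 2 * ρ := by
    calc ∑ u ∈ I, x u ^ 2 ≤ ∑ u ∈ I, 4 * ρ / p * x u := by
          refine Finset.sum_le_sum fun u hu => ?_
          rw [sq]
          exact mul_le_mul_of_nonneg_right (hxle u hu) (hxI u).1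
      _ = 4 * ρ / p * ∑ u ∈ I, x u := by rw [Finset.mul_sum]
      _ ≤ 4 * ρ / p * (2 / p) := by gcongr
      _ = 8 / p ^ 2 * ρ := by field_simp; ring
  have hprod := abs_prod_one_sub_sub_exp_le I x (fun u _ => hxI u)
  have hexp := abs_exp_neg_sub_exp_neg_le
    (Finset.sum_nonneg fun u (_ : u ∈ I) => (hxI u).1) (hA_nonneg t ht)
  calc |kaplanMeier T Δ t - (1 - Real.exp (-A t))|
      = |(∏ u ∈ I, (1 - x u) - Real.exp (-∑ u ∈ I, x u))
          + (Real.exp (-∑ u ∈ I, x u) - Real.exp (-A t))| := by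
        rw [abs_sub_comm]; unfold kaplanMeier; congr 1; ring
    _ ≤ 8 / p ^ 2 * ρ + (2 / p ^ 2 * ρ + ρ) :=
        (abs_add_le _ _).trans (add_le_add (hprod.trans hsq) (hexp.trans hΛA))
    _ = (1 + 10 / p ^ 2) * ρ := by ring

end ProductLimit

/-! ### Slopes of the greatest convex minorant -/

theorem gcm_le {S : Set ℝ} {h g₀ : ℝ → ℝ} (hg₀ : ConvexOn ℝ S g₀) (hle : ∀ t ∈ S, g₀ t ≤ h t)
    {x : ℝ} (hx : x ∈ S) : gcm S h x ≤ h x :=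
  csSup_le ⟨_, g₀, hg₀, hle, rfl⟩ fun _ ⟨_, _, hg, hy⟩ => hy ▸ hg x hx

theorem le_gcm {S : Set ℝ} {h g : ℝ → ℝ} (hg : ConvexOn ℝ S g) (hle : ∀ t ∈ S, g t ≤ h t)
    {x : ℝ} (hx : x ∈ S) : g x ≤ gcm S h x :=
  le_csSup ⟨h x, fun _ ⟨_, _, hg, hy⟩ => hy ▸ hg x hx⟩ ⟨g, hg, hle, rfl⟩

theorem convexOn_gcm {S : Set ℝ} {h g₀ : ℝ → ℝ} (hg₀ : ConvexOn ℝ S g₀)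
    (hle : ∀ t ∈ S, g₀ t ≤ h t) : ConvexOn ℝ S (gcm S h) := by
  refine ⟨hg₀.1, fun x hx y hy a b ha hb hab => ?_⟩
  refine csSup_le ⟨_, g₀, hg₀, hle, rfl⟩ ?_
  rintro _ ⟨g, hg, hgh, rfl⟩
  refine (hg.2 hx hy ha hb hab).trans ?_
  exact add_le_add (smul_le_smul_of_nonneg_left (le_gcm hg hgh hx) ha)
    (smul_le_smul_of_nonneg_left (le_gcm hg hgh hy) hb)

theorem sub_le_leftDeriv_mul {G : ℝ → ℝ} {τ s t : ℝ} (hG : ConvexOn ℝ (Icc 0 τ) G)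
    (hs : s ∈ Icc 0 τ) (ht : t ∈ Ioo 0 τ) (hst : s < t) :
    G t - G s ≤ derivWithin G (Iio t) t * (t - s) := by
  have h := hG.slope_le_leftDeriv_of_mem_interior hs (by rwa [interior_Icc]) hst
  rwa [slope_def_field, div_le_iff₀ (sub_pos.2 hst)] at h

theorem leftDeriv_mul_le_sub {G : ℝ → ℝ} {τ s t : ℝ} (hG : ConvexOn ℝ (Icc 0 τ) G)
    (hs : s ∈ Icc 0 τ) (ht : t ∈ Ioo 0 τ) (hts : t < s) :
    derivWithin G (Iio t) t * (s - t) ≤ G s - G t := by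
  have ht' : t ∈ interior (Icc 0 τ) := by rwa [interior_Icc]
  have h := (hG.leftDeriv_le_rightDeriv_of_mem_interior ht').trans
    (hG.rightDeriv_le_slope_of_mem_interior ht' hs hts)
  rwa [slope_def_field, le_div_iff₀ (sub_pos.2 hts)] at h

section Primitive

variable {f : ℝ → ℝ} {τ : ℝ}

theorem mul_le_integral_of_monotoneOn (hfi : Integrable f) (hf : MonotoneOn f (Ico 0 τ))
    {x y : ℝ} (hx : 0 ≤ x) (hxy : x ≤ y) (hy : y ≤ τ) : f x * (y - x) ≤ ∫ u in x..y, f u := by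
  have h := intervalIntegral.integral_mono_on_of_le_Ioo (f := fun _ => f x) (g := f) hxy
    intervalIntegrable_const hfi.intervalIntegrable
    (fun u hu => hf ⟨hx, (hu.1.trans hu.2).trans_le hy⟩
      ⟨hx.trans hu.1.le, hu.2.trans_le hy⟩ hu.1.le)
  rwa [intervalIntegral.integral_const, smul_eq_mul, mul_comm] at h

theorem integral_le_mul_of_monotoneOn (hfi : Integrable f) (hf : MonotoneOn f (Ico 0 τ))
    {x y : ℝ} (hx : 0 ≤ x) (hxy : x ≤ y) (hy : y < τ) : ∫ u in x..y, f u ≤ f y * (y - x) := by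
  have h := intervalIntegral.integral_mono_on_of_le_Ioo (f := f) (g := fun _ => f y) hxy
    hfi.intervalIntegrable intervalIntegrable_const
    (fun u hu => hf ⟨hx.trans hu.1.le, hu.2.trans hy⟩
      ⟨hx.trans hxy, hy⟩ hu.2.le)
  rwa [intervalIntegral.integral_const, smul_eq_mul, mul_comm] at h

theorem integral_zero_sub (hfi : Integrable f) (x y : ℝ) :
    (∫ u in 0..y, f u) - ∫ u in 0..x, f u = ∫ u in x..y, f u :=
  intervalIntegral.integral_interval_sub_left hfi.intervalIntegrable hfi.intervalIntegrable

theorem hasDerivAt_primitive (hfi : Integrable f) (hfc : ContinuousOn f (Ico 0 τ)) {t : ℝ}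
    (ht : t ∈ Ioo 0 τ) : HasDerivAt (fun t => ∫ u in 0..t, f u) (f t) t :=
  intervalIntegral.integral_hasDerivAt_right hfi.intervalIntegrable
    ((hfc.mono Ioo_subset_Ico_self).stronglyMeasurableAtFilter isOpen_Ioo t ht)
    (hfc.continuousAt (Ico_mem_nhds ht.1 ht.2))

theorem convexOn_primitive (hfi : Integrable f) (hf : MonotoneOn f (Ico 0 τ))
    (hfc : ContinuousOn f (Ico 0 τ)) : ConvexOn ℝ (Icc 0 τ) fun t => ∫ u in 0..t, f u := by
  refine MonotoneOn.convexOn_of_deriv (convex_Icc 0 τ)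
    (intervalIntegral.continuous_primitive (fun _ _ => hfi.intervalIntegrable) 0).continuousOn
    ?_ ?_
  · rw [interior_Icc]
    exact fun t ht => (hasDerivAt_primitive hfi hfc ht).differentiableAt.differentiableWithinAt
  · rw [interior_Icc]
    intro x hx y hy hxy
    rw [(hasDerivAt_primitive hfi hfc hx).deriv, (hasDerivAt_primitive hfi hfc hy).deriv]
    exact hf (Ioo_subset_Ico_self hx) (Ioo_subset_Ico_self hy) hxy

end Primitive

/-- Pathwise control of the left-hand slope of the greatest convex minorant of `h`, when `h` is
monotone and uniformly within `β` of the convex function `F t = ∫₀ᵗ f` on `[0, M']`. Away from the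
origin an error of order `ε δ` is enough for both bounds, since slopes may be compared over
distance `δ`. Near the origin the lower bound at `t` needs `β` small compared with `t`; at a
bandwidth scale this is where a rate of convergence enters. -/
theorem leftDeriv_gcm_bounds {f h : ℝ → ℝ} {τ M' M₁ ε δ β s₀ : ℝ}
    (hfi : Integrable f) (hf0 : ∀ x, 0 ≤ f x) (hf : MonotoneOn f (Ico 0 τ))
    (hfc : ContinuousOn f (Ico 0 τ)) (hε : 0 < ε) (hδ : 0 < δ) (hM' : M₁ + δ ≤ M') (hM'τ : M' < τ)
    (hmod : ∀ x ∈ Ico 0 τ, ∀ y ∈ Ico 0 τ, |x - y| ≤ δ → |f x - f y| ≤ ε)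
    (hh : Monotone h) (htail : ∫ u in M'..τ, f u ≤ ε * δ / 3)
    (hβ : β ≤ ε * δ / 3) (hβs : 2 * β ≤ ε * s₀)
    (hdev : ∀ t ∈ Icc 0 M', |h t - ∫ u in 0..t, f u| ≤ β) {t : ℝ} (ht0 : 0 < t) (htM : t ≤ M₁) :
    0 ≤ derivWithin (gcm (Icc 0 τ) h) (Iio t) t ∧
    derivWithin (gcm (Icc 0 τ) h) (Iio t) t ≤ f t + 2 * ε ∧
    (s₀ ≤ t → f t - 3 * ε ≤ derivWithin (gcm (Icc 0 τ) h) (Iio t) t) := by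
  set F : ℝ → ℝ := fun t => ∫ u in 0..t, f u with hF
  set G := gcm (Icc 0 τ) h with hGdef
  set D := derivWithin G (Iio t) t
  have hconst : ∀ s ∈ Icc 0 τ, (fun _ => h 0) s ≤ h s := fun s hs => hh hs.1
  have hconv : ConvexOn ℝ (Icc 0 τ) (fun _ : ℝ => h 0) := convexOn_const _ (convex_Icc 0 τ)
  have hG : ConvexOn ℝ (Icc 0 τ) G := convexOn_gcm hconv hconst
  have hGh : ∀ s ∈ Icc 0 τ, G s ≤ h s := fun s hs => gcm_le hconv hconst hs
  have hτ0 : 0 < τ := by linarith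
  have ht : t ∈ Ioo 0 τ := ⟨ht0, by linarith⟩
  have ht' : t ∈ Icc 0 τ := Ioo_subset_Icc_self ht
  have h0 : (0 : ℝ) ∈ Icc 0 τ := ⟨le_rfl, hτ0.le⟩
  have hM'0 : M' ∈ Icc 0 M' := ⟨by linarith, le_rfl⟩
  -- on the uncontrolled part `[M', τ]`, monotonicity of `h` gives the lower bound
  have hlow : ∀ s ∈ Icc M' τ, F s - 2 * (ε * δ / 3) ≤ h s := by
    intro s hs
    have h1 := (abs_le.1 (hdev M' hM'0)).1
    have h2 := hh hs.1
    have h3 : F s ≤ F M' + ε * δ / 3 := by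
      have hFτ := integral_zero_sub hfi M' τ
      have hFs : 0 ≤ F τ - F s := by
        rw [integral_zero_sub hfi]
        rcases hs.2.eq_or_lt with rfl | hlt
        · simp
        · refine le_trans ?_ (mul_le_integral_of_monotoneOn hfi hf (hM'0.1.trans hs.1) hs.2 le_rfl)
          exact mul_nonneg (hf0 s) (sub_nonneg.2 hs.2)
      simp only [hF] at hFs ⊢
      linarith
    simp only [hF] at h3 ⊢
    linarith
  have hFG : ∀ s ∈ Icc 0 τ, F s - 2 * (ε * δ / 3) ≤ G s := by
    refine fun s hs => le_gcm (h := h) (g := fun s => F s - 2 * (ε * δ / 3))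
      (by
        simp only [sub_eq_add_neg]
        exact (convexOn_primitive hfi hf hfc).add_const _) (fun u hu => ?_) hs
    rcases le_total M' u with hu' | hu'
    · exact hlow u ⟨hu', hu.2⟩
    · have := (abs_le.1 (hdev u ⟨hu.1, hu'⟩)).1
      simp only [hF]
      nlinarith [mul_pos hε hδ]
  have hG' : ∀ s ∈ Icc 0 M', G s ≤ F s + ε * δ / 3 := fun s hs => by
    have := (abs_le.1 (hdev s hs)).2
    have := hGh s ⟨hs.1, hs.2.trans hM'τ.le⟩
    simp only [hF]; linarith
  refine ⟨?_, ?_, fun hst => ?_⟩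
  · have h1 := sub_le_leftDeriv_mul hG h0 ht ht0
    have h2 : h 0 ≤ G t := le_gcm hconv hconst ht'
    have h3 := hGh 0 h0
    rw [sub_zero] at h1
    exact nonneg_of_mul_nonneg_left (le_trans (by linarith) h1) ht0
  · have h1 := leftDeriv_mul_le_sub hG (s := t + δ) ⟨by linarith, by linarith⟩ ht (by linarith)
    have h2 := hG' (t + δ) ⟨by linarith, by linarith⟩
    have h3 := hFG t ht'
    have h4 : F (t + δ) - F t ≤ f (t + δ) * (t + δ - t) := by
      rw [integral_zero_sub hfi]
      exact integral_le_mul_of_monotoneOn hfi hf ht0.le (by linarith) (by linarith)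
    have h5 := (abs_le.1 (hmod (t + δ) ⟨by linarith, by linarith⟩ t ⟨ht0.le, ht.2⟩
      (by rw [add_sub_cancel_left, abs_of_pos hδ]))).2
    rw [add_sub_cancel_left] at h1 h4
    refine le_of_mul_le_mul_right (h1.trans ?_) hδ
    nlinarith
  · rcases le_or_gt δ t with hδt | hδt
    · have h1 := sub_le_leftDeriv_mul hG (s := t - δ) ⟨by linarith, by linarith [ht.2]⟩ ht
        (by linarith)
      have h2 := hG' (t - δ) ⟨by linarith, by linarith⟩
      have h3 := hFG t ht'
      have h4 : f (t - δ) * (t - (t - δ)) ≤ F t - F (t - δ) := by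
        rw [integral_zero_sub hfi]
        exact mul_le_integral_of_monotoneOn hfi hf (by linarith) (by linarith) ht.2.le
      have h5 := (abs_le.1 (hmod t ⟨ht0.le, ht.2⟩ (t - δ) ⟨by linarith, by linarith [ht.2]⟩
        (by rw [sub_sub_cancel, abs_of_pos hδ]))).2
      rw [sub_sub_cancel] at h1 h4
      refine le_of_mul_le_mul_right (le_trans ?_ h1) hδ
      nlinarith
    · -- the line of slope `f 0 - ε` through `(0, -β)` is a minorant of `h`
      have hline : (f 0 - ε) * t - β ≤ G t := by
        refine le_gcm (h := h) (g := fun s => (f 0 - ε) * s - β) ?_ (fun s hs => ?_) ht'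
        · simp only [sub_eq_add_neg]
          exact ((LinearMap.mulLeft ℝ (f 0 + -ε)).convexOn (convex_Icc 0 τ)).add_const (-β)
        · have h1 := mul_le_integral_of_monotoneOn hfi hf le_rfl hs.1 hs.2
          rw [sub_zero] at h1
          rcases le_total M' s with hs' | hs'
          · have h2 := hlow s ⟨hs', hs.2⟩
            have h3 : ε * δ ≤ ε * s := by gcongr; linarith
            have h4 := (abs_nonneg _).trans (hdev 0 ⟨le_rfl, hM'0.1⟩)
            simp only [hF] at h2
            nlinarith [mul_pos hε hδ]
          · have h2 := (abs_le.1 (hdev s ⟨hs.1, hs'⟩)).1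
            nlinarith [mul_nonneg hε.le hs.1]
      have h1 := sub_le_leftDeriv_mul hG h0 ht ht0
      have h2 := hGh 0 h0
      have h3 := (abs_le.1 (hdev 0 ⟨le_rfl, hM'0.1⟩)).2
      have h4 := (abs_le.1 (hmod t ⟨ht0.le, ht.2⟩ 0 ⟨le_rfl, hτ0⟩
        (by rw [sub_zero, abs_of_pos ht0]; exact hδt.le))).2
      rw [intervalIntegral.integral_same, sub_zero] at h3
      rw [sub_zero] at h1
      refine le_of_mul_le_mul_right (le_trans ?_ h1) ht0
      nlinarith [mul_le_mul_of_nonneg_left hst hε.le]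

theorem monotoneOn_grenander {n : ℕ} (T : Fin n → ℝ) (Δ : Fin n → ℕ) (τ : ℝ) :
    MonotoneOn (grenander τ T Δ) (Ioo 0 τ) := by
  have h := (convexOn_gcm (h := kaplanMeier T Δ)
    (convexOn_const (kaplanMeier T Δ 0) (convex_Icc 0 τ))
    fun s hs => kaplanMeier_monotone T Δ hs.1).monotoneOn_leftDeriv
  rwa [interior_Icc] at h

/-! ### Boundary-corrected kernel averages -/

section Kernel

variable {k : ℝ → ℝ}

theorem IsStandardKernel.exists_abs_le (hk : IsStandardKernel k) (hkc : Continuous k) :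
    ∃ K, ∀ u, |k u| ≤ K :=
  hkc.bounded_above_of_compact_support
    (HasCompactSupport.of_support_subset_isCompact isCompact_Icc hk.support_subset)

theorem IsStandardKernel.abs_mul_le (hk : IsStandardKernel k) (u : ℝ) : |u * k u| ≤ |k u| := by
  rw [abs_mul]
  by_cases h : k u = 0
  · simp [h]
  · exact mul_le_of_le_one_left (abs_nonneg _) (abs_le.2 (hk.support_subset h))

theorem truncMoment_intervalIntegrable (hkc : Continuous k) (j : ℕ) (a b : ℝ) :
    IntervalIntegrable (fun u => u ^ j * k u) volume a b :=
  (by fun_prop : Continuous fun u => u ^ j * k u).intervalIntegrable _ _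

theorem continuous_truncMoment (hkc : Continuous k) (j : ℕ) : Continuous (truncMoment k j) :=
  intervalIntegral.continuous_primitive (truncMoment_intervalIntegrable hkc j) (-1)

theorem IsStandardKernel.integral_eq (hk : IsStandardKernel k) : ∫ u in (-1)..1, k u = 1 := by
  rw [intervalIntegral.integral_of_le (by norm_num), ← integral_Icc_eq_integral_Ioc,
    setIntegral_eq_integral_of_forall_compl_eq_zero, hk.integral_eq_one]
  exact fun u hu => by_contra fun h => hu (hk.support_subset h)

theorem IsStandardKernel.truncMoment_zero_pos (hk : IsStandardKernel k) (hkc : Continuous k)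
    {s : ℝ} (hs : 0 ≤ s) : 0 < truncMoment k 0 s := by
  have hi : ∀ a b, IntervalIntegrable k volume a b := fun a b => hkc.intervalIntegrable a b
  have h1 : ∫ u in (-1)..0, k u = ∫ u in (0 : ℝ)..1, k u := by
    have := intervalIntegral.integral_comp_neg (a := (0 : ℝ)) (b := 1) k
    simpa [hk.symm] using this.symm
  have h2 := intervalIntegral.integral_add_adjacent_intervals (hi (-1) 0) (hi 0 1)
  rw [hk.integral_eq, ← h1] at h2
  have h3 := intervalIntegral.integral_add_adjacent_intervals (hi (-1) 0) (hi 0 s)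
  have h4 : 0 ≤ ∫ u in (0 : ℝ)..s, k u := intervalIntegral.integral_nonneg hs fun u _ => hk.nonneg u
  simp only [truncMoment, pow_zero, one_mul]
  linarith

/-- Strict Cauchy–Schwarz for the truncated moments: the boundary system is nonsingular. -/
theorem IsStandardKernel.boundaryDet_pos (hk : IsStandardKernel k) (hkc : Continuous k)
    {s : ℝ} (hs : 0 ≤ s) : 0 < boundaryDet k s := by
  have h0 := hk.truncMoment_zero_pos hkc hs
  set l := truncMoment k 1 s / truncMoment k 0 s with hl
  -- `l` is the mean of the truncated kernel, so the integral below is its centred second moment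
  have hpos : 0 < ∫ u in (-1)..s, (u - l) ^ 2 * k u := by
    refine intervalIntegral.integral_pos (by linarith) (by fun_prop)
      (fun u _ => mul_nonneg (sq_nonneg _) (hk.nonneg u)) ?_
    by_contra! hcon
    refine h0.ne' ?_
    have : ∫ u in (-1)..s, u ^ 0 * k u = ∫ u in (-1)..s, (0 : ℝ) := by
      refine intervalIntegral.integral_congr_ae ?_
      filter_upwards [compl_mem_ae_iff.2 (measure_singleton l)] with u hu hus
      rw [uIoc_of_le (by linarith)] at hus
      have h1 := hcon u (Ioc_subset_Icc_self hus)
      have h2 : 0 < (u - l) ^ 2 := by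
        have : u - l ≠ 0 := sub_ne_zero.2 hu
        positivity
      have h3 : k u = 0 := le_antisymm (by nlinarith [hk.nonneg u]) (hk.nonneg u)
      rw [h3, mul_zero]
    simpa [truncMoment] using this
  have hexp : ∫ u in (-1)..s, (u - l) ^ 2 * k u
      = truncMoment k 2 s - 2 * l * truncMoment k 1 s + l ^ 2 * truncMoment k 0 s := by
    unfold truncMoment
    rw [← intervalIntegral.integral_const_mul, ← intervalIntegral.integral_const_mul,
      ← intervalIntegral.integral_sub, ← intervalIntegral.integral_add]
    · congr 1; ext u; ring
    all_goals exact Continuous.intervalIntegrable (by fun_prop) _ _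
  rw [hexp] at hpos
  have h1 : l * truncMoment k 0 s = truncMoment k 1 s := div_mul_cancel₀ _ h0.ne'
  unfold boundaryDet
  have := mul_pos hpos h0
  nlinarith

theorem IsStandardKernel.exists_abs_boundaryKernel_le (hk : IsStandardKernel k)
    (hkc : Continuous k) : ∃ K, 0 < K ∧ ∀ τ b x u, 0 < b → 0 ≤ x → x < τ - b →
      |boundaryKernel k τ b x u| ≤ K := by
  obtain ⟨K₀, hK₀⟩ := hk.exists_abs_le hkc
  have hdet : ∀ s ∈ Icc (0 : ℝ) 1, boundaryDet k s ≠ 0 := fun s hs =>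
    (hk.boundaryDet_pos hkc hs.1).ne'
  have hdc : Continuous (boundaryDet k) :=
    ((continuous_truncMoment hkc 0).mul (continuous_truncMoment hkc 2)).sub
      ((continuous_truncMoment hkc 1).pow 2)
  obtain ⟨K₁, hK₁⟩ := isCompact_Icc.exists_bound_of_continuousOn (f := phi k)
    ((continuous_truncMoment hkc 2).continuousOn.div hdc.continuousOn hdet)
  obtain ⟨K₂, hK₂⟩ := isCompact_Icc.exists_bound_of_continuousOn (f := psi k)
    ((continuous_truncMoment hkc 1).neg.continuousOn.div hdc.continuousOn hdet)
  have hK₀0 : 0 ≤ K₀ := (abs_nonneg _).trans (hK₀ 0)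
  have hK₁0 : 0 ≤ K₁ := (norm_nonneg _).trans (hK₁ 0 ⟨le_rfl, zero_le_one⟩)
  have hK₂0 : 0 ≤ K₂ := (norm_nonneg _).trans (hK₂ 0 ⟨le_rfl, zero_le_one⟩)
  refine ⟨K₁ * K₀ + K₂ * K₀ + K₀ + 1, by positivity, fun τ b x u hb hx hxτ => ?_⟩
  unfold boundaryKernel
  split_ifs with hxb
  · have hs : x / b ∈ Icc (0 : ℝ) 1 := ⟨by positivity, (div_le_one hb).2 hxb⟩
    calc _ ≤ |phi k (x / b)| * |k u| + |psi k (x / b)| * |u * k u| := by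
          rw [← abs_mul, ← abs_mul]; exact abs_add_le _ _
      _ ≤ K₁ * K₀ + K₂ * K₀ := add_le_add
          (mul_le_mul (hK₁ _ hs) (hK₀ u) (abs_nonneg _) hK₁0)
          (mul_le_mul (hK₂ _ hs) ((hk.abs_mul_le u).trans (hK₀ u)) (abs_nonneg _) hK₂0)
      _ ≤ _ := by linarith
  · refine (hK₀ u).trans ?_
    have := mul_nonneg hK₁0 hK₀0
    have := mul_nonneg hK₂0 hK₀0
    linarith

theorem continuous_boundaryKernel (hkc : Continuous k) (τ b x : ℝ) :
    Continuous (boundaryKernel k τ b x) := by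
  unfold boundaryKernel
  split_ifs <;> fun_prop

/-- Away from the right end point, the boundary kernel has total mass one on the window. -/
theorem IsStandardKernel.integral_boundaryKernel (hk : IsStandardKernel k) (hkc : Continuous k)
    {τ b x : ℝ} (hb : 0 < b) (hx : 0 ≤ x) (hxτ : x < τ - b) :
    ∫ u in (max (x - b) 0)..(min (x + b) τ), b⁻¹ * boundaryKernel k τ b x ((x - u) / b) = 1 := by
  rw [min_eq_left (by linarith), intervalIntegral.integral_const_mul]
  simp_rw [sub_div]
  rw [intervalIntegral.integral_comp_sub_div _ hb.ne', smul_eq_mul, inv_mul_cancel_left₀ hb.ne',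
    show x / b - (x + b) / b = -1 by field_simp; ring]
  rcases le_or_gt x b with hxb | hxb
  · rw [max_eq_right (by linarith), zero_div, sub_zero]
    have hs : 0 ≤ x / b := by positivity
    have hspec := ((boundaryCoeff_spec k (x / b) (hk.boundaryDet_pos hkc hs).ne' _ _).2
      ⟨rfl, rfl⟩).1
    simp only [boundaryKernel, if_pos hxb]
    rw [intervalIntegral.integral_add, intervalIntegral.integral_const_mul,
      intervalIntegral.integral_const_mul, hspec]
    all_goals exact Continuous.intervalIntegrable (by fun_prop) _ _
  · rw [max_eq_left (by linarith), show x / b - (x - b) / b = 1 by field_simp; ring]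
    simp only [boundaryKernel, if_neg hxb.not_ge, if_pos hxτ]
    exact hk.integral_eq

/-- A boundary-corrected kernel average of a monotone function `D` is close to `v` if `D` is
within `E` of `v` on the window, except on the short interval `(0, s₀)`, where it is within `B`. -/
theorem abs_kernel_average_sub_le (hk : IsStandardKernel k) (hkc : Continuous k) {K : ℝ}
    {τ b x v E B s₀ : ℝ} {D : ℝ → ℝ} (hb : 0 < b) (hx : 0 ≤ x) (hxτ : x < τ - b)
    (hK : ∀ u, |boundaryKernel k τ b x u| ≤ K) (hD : MonotoneOn D (Ioo 0 τ)) (hE : 0 ≤ E)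
    (hB : 0 ≤ B) (hs₀ : 0 ≤ s₀)
    (hDB : ∀ u, 0 < u → |u - x| ≤ b → |D u - v| ≤ B)
    (hDE : ∀ u, s₀ ≤ u → 0 < u → |u - x| ≤ b → |D u - v| ≤ E) :
    |(∫ u in (max (x - b) 0)..(min (x + b) τ),
      b⁻¹ * boundaryKernel k τ b x ((x - u) / b) * D u) - v| ≤ K * (2 * E + B * s₀ / b) := by
  have hone := hk.integral_boundaryKernel hkc hb hx hxτ
  have hK0 : 0 ≤ K := (abs_nonneg _).trans (hK 0)
  rw [min_eq_left (by linarith : x + b ≤ τ)] at hone ⊢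
  have hle : max (x - b) 0 ≤ x + b := max_le (by linarith) (by linarith)
  set w : ℝ → ℝ := fun u => b⁻¹ * boundaryKernel k τ b x ((x - u) / b) with hw
  have hwc : Continuous w :=
    continuous_const.mul ((continuous_boundaryKernel hkc τ b x).comp (by fun_prop))
  have hmem : ∀ u ∈ Ioc (max (x - b) 0) (x + b), 0 < u ∧ |u - x| ≤ b := fun u hu =>
    ⟨(le_max_right _ _).trans_lt hu.1,
      abs_le.2 ⟨by linarith [(le_max_left (x - b) 0).trans_lt hu.1], by linarith [hu.2]⟩⟩
  have hDi : IntervalIntegrable D volume (max (x - b) 0) (x + b) := by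
    rw [intervalIntegrable_iff_integrableOn_Ioc_of_le hle]
    have hsub : Ioc (max (x - b) 0) (x + b) ⊆ Ioo 0 τ := fun u hu =>
      ⟨(hmem u hu).1, hu.2.trans_lt (by linarith)⟩
    refine Integrable.of_bound
      (aemeasurable_restrict_of_monotoneOn measurableSet_Ioc (hD.mono hsub)).aestronglyMeasurable
      (B + |v|) ?_
    refine (ae_restrict_iff' measurableSet_Ioc).2 (ae_of_all _ fun u hu => ?_)
    calc ‖D u‖ = |(D u - v) + v| := by rw [Real.norm_eq_abs]; ring_nf
      _ ≤ |D u - v| + |v| := abs_add_le _ _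
      _ ≤ B + |v| := by linarith [hDB u (hmem u hu).1 (hmem u hu).2]
  have heq : (∫ u in (max (x - b) 0)..(x + b), w u * D u) - v
      = ∫ u in (max (x - b) 0)..(x + b), w u * (D u - v) := by
    simp_rw [mul_sub]
    rw [intervalIntegral.integral_sub (hDi.continuousOn_mul hwc.continuousOn)
      ((hwc.intervalIntegrable _ _).mul_const v), intervalIntegral.integral_mul_const, hone, one_mul]
  rw [heq, ← Real.norm_eq_abs]
  have hind : IntegrableOn ((Iio s₀).indicator fun _ => B) (Ioc (max (x - b) 0) (x + b)) :=
    (integrable_const B).indicator measurableSet_Iio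
  have hbi : IntervalIntegrable (fun u => b⁻¹ * K * (E + (Iio s₀).indicator (fun _ => B) u)) volume
      (max (x - b) 0) (x + b) :=
    (intervalIntegrable_const.add
      ((intervalIntegrable_iff_integrableOn_Ioc_of_le hle).2 hind)).const_mul _
  refine (intervalIntegral.norm_integral_le_of_norm_le hle (ae_of_all _ fun u hu => ?_) hbi).trans ?_
  · have hu' := hmem u hu
    rw [norm_mul, Real.norm_eq_abs, Real.norm_eq_abs]
    have h1 : |w u| ≤ b⁻¹ * K := by
      rw [hw, abs_mul, abs_of_pos (inv_pos.2 hb)]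
      exact mul_le_mul_of_nonneg_left (hK _) (inv_pos.2 hb).le
    refine mul_le_mul h1 ?_ (abs_nonneg _) (by positivity)
    by_cases hus : u < s₀
    · rw [indicator_of_mem (mem_Iio.2 hus)]
      linarith [hDB u hu'.1 hu'.2]
    · rw [indicator_of_notMem (by simpa using hus), add_zero]
      exact hDE u (not_lt.1 hus) hu'.1 hu'.2
  · rw [intervalIntegral.integral_const_mul, intervalIntegral.integral_add intervalIntegrable_const
      ((intervalIntegrable_iff_integrableOn_Ioc_of_le hle).2 hind),
      intervalIntegral.integral_const, smul_eq_mul]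
    have h1 : ∫ u in (max (x - b) 0)..(x + b), (Iio s₀).indicator (fun _ => B) u ≤ s₀ * B := by
      rw [intervalIntegral.integral_of_le hle, setIntegral_indicator measurableSet_Iio,
        setIntegral_const, smul_eq_mul]
      refine mul_le_mul_of_nonneg_right ?_ hB
      calc volume.real (Ioc (max (x - b) 0) (x + b) ∩ Iio s₀)
          ≤ volume.real (Ioc 0 s₀) := measureReal_mono
            (fun u hu => ⟨(hmem u hu.1).1, (mem_Iio.1 hu.2).le⟩) (by simp)
        _ = s₀ := by simp [hs₀]
    have h2 : (x + b - max (x - b) 0) * E ≤ 2 * b * E :=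
      mul_le_mul_of_nonneg_right (by linarith [le_max_left (x - b) 0]) hE
    calc _ ≤ b⁻¹ * K * (2 * b * E + s₀ * B) := by gcongr
      _ = K * (2 * E + B * s₀ / b) := by field_simp

end Kernel

/-! ### Uniform deviations of averages of monotone processes -/

section Deviation

variable {Ω : Type*} [MeasurableSpace Ω] {P : Measure Ω} [IsProbabilityMeasure P]

/-- Two-sided Hoeffding inequality for averages of independent variables with values in `[0, B]`. -/
theorem measureReal_le_abs_average_sub_le {Y : ℕ → Ω → ℝ} {B m ε : ℝ}
    (hmeas : ∀ i, Measurable (Y i)) (hindep : iIndepFun Y P)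
    (hrange : ∀ i ω, Y i ω ∈ Icc 0 B) (hmean : ∀ i, ∫ ω, Y i ω ∂P = m) (hε : 0 ≤ ε)
    {n : ℕ} (hn : 0 < n) :
    P.real {ω | ε ≤ |(∑ i ∈ Finset.range n, Y i ω) / n - m|}
      ≤ 2 * Real.exp (-(2 * n * ε ^ 2 / B ^ 2)) := by
  have hn' : (0 : ℝ) < n := by exact_mod_cast hn
  have hsub : ∀ i, HasSubgaussianMGF (fun ω => Y i ω - m) ((‖B - 0‖₊ / 2) ^ 2) P := fun i => by
    have := hasSubgaussianMGF_of_mem_Icc (hmeas i).aemeasurable (ae_of_all P (hrange i))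
    rwa [hmean i] at this
  have hi : iIndepFun (fun i ω => Y i ω - m) P :=
    hindep.comp (fun _ y => y - m) fun _ => measurable_id.sub_const m
  have hi' : iIndepFun (fun i ω => -(Y i ω - m)) P :=
    hindep.comp (fun _ y => -(y - m)) fun _ => (measurable_id.sub_const m).neg
  have hc : -(n * ε) ^ 2 / (2 * n * (((‖B - 0‖₊ / 2) ^ 2 : NNReal) : ℝ))
      = -(2 * n * ε ^ 2 / B ^ 2) := by
    push_cast
    rw [sub_zero, Real.norm_eq_abs, div_pow, sq_abs]
    rcases eq_or_ne B 0 with rfl | hB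
    · simp
    · field_simp
  have h1 := HasSubgaussianMGF.measure_sum_range_ge_le_of_iIndepFun hi (n := n)
    (fun i _ => hsub i) (mul_nonneg hn'.le hε)
  have h2 := HasSubgaussianMGF.measure_sum_range_ge_le_of_iIndepFun hi' (n := n)
    (fun i _ => (hsub i).neg) (mul_nonneg hn'.le hε)
  rw [hc] at h1 h2
  have hsplit : {ω | ε ≤ |(∑ i ∈ Finset.range n, Y i ω) / n - m|} ⊆
      {ω | n * ε ≤ ∑ i ∈ Finset.range n, (Y i ω - m)} ∪
      {ω | n * ε ≤ ∑ i ∈ Finset.range n, -(Y i ω - m)} := by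
    intro ω hω
    simp only [mem_ofPred_eq, mem_union, Finset.sum_neg_distrib, Finset.sum_sub_distrib,
      Finset.sum_const, Finset.card_range, nsmul_eq_mul] at hω ⊢
    rcases le_abs.1 hω with h | h
    · left
      have := mul_le_mul_of_nonneg_left h hn'.le
      rwa [mul_sub, mul_div_cancel₀ _ hn'.ne'] at this
    · right
      have := mul_le_mul_of_nonneg_left h hn'.le
      rwa [mul_neg, mul_sub, mul_div_cancel₀ _ hn'.ne'] at this
  calc _ ≤ _ := measureReal_mono hsplit
    _ ≤ _ := measureReal_union_le _ _
    _ ≤ _ := by linarith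

/-- A continuous function on `[a, b]` has a subdivision with equal increments. -/
theorem exists_equal_increment_grid {A : ℝ → ℝ} {a b : ℝ} (hab : a ≤ b) (hA : ContinuousOn A (Icc a b))
    (hmono : A a ≤ A b) {n : ℕ} (hn : 0 < n) :
    ∃ s : ℕ → ℝ, s 0 = a ∧ s n = b ∧
      ∀ j ≤ n, s j ∈ Icc a b ∧ A (s j) = A a + j * ((A b - A a) / n) := by
  have hn' : (0 : ℝ) < n := by exact_mod_cast hn
  have h : ∀ j : ℕ, ∃ x, (j = 0 → x = a) ∧ (j = n → x = b) ∧
      (j ≤ n → x ∈ Icc a b ∧ A x = A a + j * ((A b - A a) / n)) := by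
    intro j
    rcases eq_or_ne j 0 with rfl | h0
    · exact ⟨a, fun _ => rfl, fun h => absurd h hn.ne, fun _ => ⟨left_mem_Icc.2 hab, by simp⟩⟩
    rcases eq_or_ne j n with rfl | h1
    · exact ⟨b, fun h => absurd h h0, fun _ => rfl, fun _ => ⟨right_mem_Icc.2 hab, by
        field_simp; ring⟩⟩
    by_cases hj : j ≤ n
    · have hj' : (j : ℝ) ≤ n := by exact_mod_cast hj
      have hmem : A a + j * ((A b - A a) / n) ∈ Icc (A a) (A b) := by
        refine ⟨le_add_of_nonneg_right (mul_nonneg (by positivity)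
          (div_nonneg (sub_nonneg.2 hmono) hn'.le)), ?_⟩
        have : j * ((A b - A a) / n) ≤ n * ((A b - A a) / n) :=
          mul_le_mul_of_nonneg_right hj' (div_nonneg (sub_nonneg.2 hmono) hn'.le)
        rw [mul_div_cancel₀ _ hn'.ne'] at this
        linarith
      obtain ⟨x, hx, hxA⟩ := intermediate_value_Icc hab hA hmem
      exact ⟨x, fun h => absurd h h0, fun h => absurd h h1, fun _ => ⟨hx, hxA⟩⟩
    · exact ⟨a, fun h => absurd h h0, fun h => absurd h h1, fun h => absurd h hj⟩
  choose s hs0 hsn hs using h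
  exact ⟨s, hs0 0 rfl, hsn n rfl, hs⟩

theorem exists_mem_Icc_grid {s : ℕ → ℝ} {n : ℕ} (hn : 0 < n) {t : ℝ} (h0 : s 0 ≤ t)
    (h1 : t ≤ s n) : ∃ j < n, t ∈ Icc (s j) (s (j + 1)) := by
  classical
  have hex : ∃ j, t ≤ s (j + 1) := ⟨n - 1, by rwa [Nat.sub_add_cancel hn]⟩
  refine ⟨Nat.find hex, ?_, ?_, Nat.find_spec hex⟩
  · have : Nat.find hex ≤ n - 1 := Nat.find_min' hex (by rwa [Nat.sub_add_cancel hn])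
    omega
  · rcases Nat.eq_zero_or_pos (Nat.find hex) with h | h
    · rwa [h]
    · have := Nat.find_min hex (Nat.sub_lt h one_pos)
      rw [Nat.sub_add_cancel (Nat.one_le_iff_ne_zero.2 h.ne')] at this
      exact (not_le.1 this).le

theorem tendsto_natCast_mul_exp_neg_rpow {β c : ℝ} (hβ : 0 < β) (hc : 0 < c) :
    Tendsto (fun n : ℕ => (n : ℝ) * Real.exp (-c * (n : ℝ) ^ β)) atTop (𝓝 0) := by
  refine ((tendsto_rpow_mul_exp_neg_mul_atTop_nhds_zero β⁻¹ c hc).comp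
    ((tendsto_rpow_atTop hβ).comp tendsto_natCast_atTop_atTop)).congr fun n => ?_
  simp only [Function.comp_apply]
  rw [Real.rpow_rpow_inv (Nat.cast_nonneg n) hβ.ne']

/-- Uniform deviation bound for averages of independent monotone bounded processes: at any rate
slower than `n ^ (-1/2)` by a power of `n`, the averages are uniformly close to a continuous mean
function. Hoeffding's inequality applies at the points of a grid with equal mean increments, and
monotonicity interpolates between them. -/
theorem tendsto_measure_uniform_deviation {Y : ℕ → ℝ → Ω → ℝ} {A : ℝ → ℝ} {a b B : ℝ} (hab : a ≤ b)
    (hB : 0 < B) (hmeas : ∀ i, ∀ t ∈ Icc a b, Measurable (Y i t))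
    (hindep : ∀ t ∈ Icc a b, iIndepFun (fun i => Y i t) P)
    (hrange : ∀ i, ∀ t ∈ Icc a b, ∀ ω, Y i t ω ∈ Icc 0 B)
    (hmono : ∀ i ω, MonotoneOn (fun t => Y i t ω) (Icc a b))
    (hmean : ∀ i, ∀ t ∈ Icc a b, ∫ ω, Y i t ω ∂P = A t) (hA : ContinuousOn A (Icc a b))
    {α κ : ℝ} (hα : α < 1 / 2) (hκ : 0 < κ) {r : ℕ → ℝ}
    (hr : ∀ᶠ n : ℕ in atTop, κ * (n : ℝ) ^ (-α) ≤ r n) :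
    Tendsto (fun n : ℕ => P {ω | ¬ ∀ t ∈ Icc a b,
      |(∑ i ∈ Finset.range n, Y i t ω) / n - A t| ≤ r n}) atTop (𝓝 0) := by
  have ha : a ∈ Icc a b := left_mem_Icc.2 hab
  have hb : b ∈ Icc a b := right_mem_Icc.2 hab
  have hint : ∀ i, ∀ t ∈ Icc a b, Integrable (Y i t) P := fun i t ht =>
    Integrable.of_mem_Icc 0 B (hmeas i t ht).aemeasurable (ae_of_all P (hrange i t ht))
  have hAmono : MonotoneOn A (Icc a b) := fun s hs t ht hst => by
    rw [← hmean 0 s hs, ← hmean 0 t ht]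
    exact integral_mono (hint 0 s hs) (hint 0 t ht) fun ω => hmono 0 ω hs ht hst
  have hAB : A b - A a ≤ B := by
    have h1 : 0 ≤ A a := by
      rw [← hmean 0 a ha]; exact integral_nonneg fun ω => (hrange 0 a ha ω).1
    have h2 : A b ≤ B := by
      rw [← hmean 0 b hb]
      calc ∫ ω, Y 0 b ω ∂P ≤ ∫ _, B ∂P :=
            integral_mono (hint 0 b hb) (integrable_const B) fun ω => (hrange 0 b hb ω).2
        _ = B := by simp
    linarith
  have hβ : 0 < 1 - 2 * α := by linarith
  set c := κ ^ 2 / (2 * B ^ 2) with hc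
  have hlim : Tendsto (fun n : ℕ => ENNReal.ofReal
      (4 * ((n : ℝ) * Real.exp (-c * (n : ℝ) ^ (1 - 2 * α))))) atTop (𝓝 0) := by
    have := (tendsto_natCast_mul_exp_neg_rpow hβ (c := c) (by positivity)).const_mul 4
    rw [mul_zero] at this
    simpa using ENNReal.tendsto_ofReal this
  refine tendsto_of_tendsto_of_tendsto_of_le_of_le' tendsto_const_nhds hlim
    (Eventually.of_forall fun _ => zero_le) ?_
  have hlarge : ∀ᶠ n : ℕ in atTop, 2 * B / κ ≤ (n : ℝ) ^ (1 - α) :=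
    ((tendsto_rpow_atTop (by linarith : 0 < 1 - α)).comp
      tendsto_natCast_atTop_atTop).eventually_ge_atTop _
  filter_upwards [hr, hlarge, eventually_gt_atTop 0] with n hrn hln hn
  have hn' : (0 : ℝ) < n := by exact_mod_cast hn
  have hpow : 0 < (n : ℝ) ^ (-α) := Real.rpow_pos_of_pos hn' _
  have hr0 : 0 ≤ r n := (by positivity : 0 ≤ κ * (n : ℝ) ^ (-α)).trans hrn
  have hstep : B / n ≤ r n / 2 := by
    have e : (n : ℝ) ^ (1 - α) = n * (n : ℝ) ^ (-α) := by
      rw [sub_eq_add_neg, Real.rpow_add hn', Real.rpow_one]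
    rw [e, div_le_iff₀ hκ] at hln
    rw [div_le_iff₀ hn']
    nlinarith [mul_le_mul_of_nonneg_right hrn hn'.le]
  obtain ⟨s, hs0, hsn, hs⟩ := exists_equal_increment_grid hab hA (hAmono ha hb hab) hn
  have hsub : {ω | ¬ ∀ t ∈ Icc a b, |(∑ i ∈ Finset.range n, Y i t ω) / n - A t| ≤ r n} ⊆
      ⋃ j ∈ Finset.range (n + 1),
        {ω | r n / 2 ≤ |(∑ i ∈ Finset.range n, Y i (s j) ω) / n - A (s j)|} := by
    intro ω hω
    by_contra hcon
    refine hω fun t ht => ?_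
    simp only [mem_iUnion, mem_ofPred_eq, Finset.mem_range, not_exists, not_le] at hcon
    obtain ⟨j, hj, hjt⟩ := exists_mem_Icc_grid hn (s := s) (hs0.trans_le ht.1) (ht.2.trans_eq hsn.symm)
    obtain ⟨hj1, hj2⟩ := hs j hj.le
    obtain ⟨hj3, hj4⟩ := hs (j + 1) hj
    have hinc : A (s (j + 1)) - A (s j) ≤ r n / 2 := by
      have : A (s (j + 1)) - A (s j) = (A b - A a) / n := by rw [hj2, hj4]; push_cast; ring
      rw [this]
      exact (div_le_div_of_nonneg_right hAB hn'.le).trans hstep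
    have e1 := abs_lt.1 (hcon j (by omega))
    have e2 := abs_lt.1 (hcon (j + 1) (by omega))
    have m1 : (∑ i ∈ Finset.range n, Y i (s j) ω) / n ≤ (∑ i ∈ Finset.range n, Y i t ω) / n :=
      div_le_div_of_nonneg_right (Finset.sum_le_sum fun i _ => hmono i ω hj1 ht hjt.1) hn'.le
    have m2 : (∑ i ∈ Finset.range n, Y i t ω) / n ≤ (∑ i ∈ Finset.range n, Y i (s (j + 1)) ω) / n :=
      div_le_div_of_nonneg_right (Finset.sum_le_sum fun i _ => hmono i ω ht hj3 hjt.2) hn'.le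
    have a1 := hAmono hj1 ht hjt.1
    have a2 := hAmono ht hj3 hjt.2
    rw [abs_le]
    constructor <;> linarith [e1.1, e1.2, e2.1, e2.2]
  have hone : ∀ j ∈ Finset.range (n + 1),
      P.real {ω | r n / 2 ≤ |(∑ i ∈ Finset.range n, Y i (s j) ω) / n - A (s j)|}
        ≤ 2 * Real.exp (-c * (n : ℝ) ^ (1 - 2 * α)) := by
    intro j hj
    have hsj := (hs j (by simpa [Nat.lt_succ_iff] using hj)).1
    refine (measureReal_le_abs_average_sub_le (fun i => hmeas i _ hsj) (hindep _ hsj)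
      (fun i => hrange i _ hsj) (fun i => hmean i _ hsj) (by positivity) hn).trans ?_
    gcongr
    have e : (n : ℝ) ^ (1 - 2 * α) = n * ((n : ℝ) ^ (-α)) ^ 2 := by
      rw [← Real.rpow_natCast, ← Real.rpow_mul hn'.le, sub_eq_add_neg, Real.rpow_add hn',
        Real.rpow_one]
      push_cast; ring_nf
    rw [e, hc, neg_mul]
    refine neg_le_neg ?_
    calc κ ^ 2 / (2 * B ^ 2) * (n * ((n : ℝ) ^ (-α)) ^ 2)
        = 2 * n * (κ * (n : ℝ) ^ (-α) / 2) ^ 2 / B ^ 2 := by field_simp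
      _ ≤ 2 * n * (r n / 2) ^ 2 / B ^ 2 := by gcongr
  rw [← ofReal_measureReal]
  refine ENNReal.ofReal_le_ofReal ?_
  calc _ ≤ _ := measureReal_mono hsub (measure_ne_top _ _)
    _ ≤ _ := measureReal_biUnion_finset_le _ _
    _ ≤ ∑ _j ∈ Finset.range (n + 1), 2 * Real.exp (-c * (n : ℝ) ^ (1 - 2 * α)) :=
        Finset.sum_le_sum hone
    _ = (n + 1) * (2 * Real.exp (-c * (n : ℝ) ^ (1 - 2 * α))) := by simp
    _ ≤ (2 * n) * (2 * Real.exp (-c * (n : ℝ) ^ (1 - 2 * α))) := by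
        gcongr
        have : (1 : ℝ) ≤ n := by exact_mod_cast hn
        linarith
    _ = _ := by ring

end Deviation

/-! ### The random censorship model -/

section Density

theorem measureReal_eq_setIntegral {μ : Measure ℝ} {f : ℝ → ℝ} (hf : Measurable f) (hf0 : ∀ x, 0 ≤ f x)
    (hμ : μ = volume.withDensity fun x => ENNReal.ofReal (f x)) {s : Set ℝ}
    (hs : MeasurableSet s) : μ.real s = ∫ x in s, f x := by
  rw [integral_eq_lintegral_of_nonneg_ae (ae_of_all _ hf0) hf.aestronglyMeasurable,
    measureReal_def, hμ, withDensity_apply _ hs]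

variable {μ : Measure ℝ} [IsProbabilityMeasure μ] {f : ℝ → ℝ}

theorem integrable_of_law (hf : Measurable f) (hf0 : ∀ x, 0 ≤ f x)
    (hμ : μ = volume.withDensity fun x => ENNReal.ofReal (f x)) : Integrable f := by
  refine ⟨hf.aestronglyMeasurable, ?_⟩
  rw [hasFiniteIntegral_iff_ofReal (ae_of_all _ hf0)]
  have h : μ univ = ∫⁻ x, ENNReal.ofReal (f x) := by
    rw [hμ, withDensity_apply _ MeasurableSet.univ, Measure.restrict_univ]
  rw [← h]
  exact measure_lt_top μ univ

theorem measureReal_Ici_eq_sub (hf : Measurable f) (hf0 : ∀ x, 0 ≤ f x)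
    (hμ : μ = volume.withDensity fun x => ENNReal.ofReal (f x)) (s : ℝ) :
    μ.real (Ici s) = μ.real (Ici 0) - ∫ x in 0..s, f x := by
  have hfi := integrable_of_law hf hf0 hμ
  have h := intervalIntegral.integral_Ioi_sub_Ioi' (a := 0) (b := s) hfi.integrableOn
    hfi.integrableOn
  rw [measureReal_eq_setIntegral hf hf0 hμ measurableSet_Ici,
    measureReal_eq_setIntegral hf hf0 hμ measurableSet_Ici, integral_Ici_eq_integral_Ioi,
    integral_Ici_eq_integral_Ioi]
  linarith

theorem continuous_measureReal_Ici (hf : Measurable f) (hf0 : ∀ x, 0 ≤ f x)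
    (hμ : μ = volume.withDensity fun x => ENNReal.ofReal (f x)) :
    Continuous fun s => μ.real (Ici s) := by
  have hfi := integrable_of_law hf hf0 hμ
  have h : Continuous fun s => μ.real (Ici 0) - ∫ x in 0..s, f x := continuous_const.sub
    (intervalIntegral.continuous_primitive (fun _ _ => hfi.intervalIntegrable) 0)
  exact h.congr fun s => (measureReal_Ici_eq_sub hf hf0 hμ s).symm

theorem measureReal_Ici_zero (hf : Measurable f) (hf0 : ∀ x, 0 ≤ f x) (hfneg : ∀ x < 0, f x = 0)
    (hμ : μ = volume.withDensity fun x => ENNReal.ofReal (f x)) : μ.real (Ici 0) = 1 := by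
  have h : μ.real (Iio 0) = 0 := by
    rw [measureReal_eq_setIntegral hf hf0 hμ measurableSet_Iio]
    exact setIntegral_eq_zero_of_forall_eq_zero hfneg
  have h2 := probReal_compl_eq_one_sub (μ := μ) (measurableSet_Iio (a := (0 : ℝ)))
  rwa [compl_Iio, h, sub_zero] at h2

theorem measureReal_Ici_pos_of_lt_rightEndpoint {t : ℝ} (h : (t : EReal) < rightEndpoint μ) :
    0 < μ.real (Ici t) := by
  obtain ⟨_, ⟨x, hx, rfl⟩, hxt⟩ := lt_sSup_iff.1 h
  have hx' : cdf μ x < 1 := hx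
  rw [cdf_eq_real] at hx'
  have h2 := probReal_compl_eq_one_sub (μ := μ) (measurableSet_Iic (a := x))
  rw [compl_Iic] at h2
  calc 0 < μ.real (Ioi x) := by rw [h2]; linarith
    _ ≤ μ.real (Ici t) := measureReal_mono fun y hy =>
      ((EReal.coe_lt_coe_iff.1 hxt).trans hy).le

/-- The cumulative hazard `∫ f / S` of a law with density `f` on `[0, ∞)` and survival function
`S` equals `-log S` on an interval where `f` is continuous and `S` is positive. -/
theorem setIntegral_Iic_inv_survival (hf : Measurable f) (hf0 : ∀ x, 0 ≤ f x)
    (hfneg : ∀ x < 0, f x = 0) (hμ : μ = volume.withDensity fun x => ENNReal.ofReal (f x))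
    {τ t : ℝ} (hfc : ContinuousOn f (Ico 0 τ)) (ht0 : 0 ≤ t) (htτ : t < τ)
    (hpos : 0 < μ.real (Ici t)) :
    ∫ x in Iic t, (μ.real (Ici x))⁻¹ ∂μ = -Real.log (μ.real (Ici t)) := by
  set S : ℝ → ℝ := fun s => μ.real (Ici s) with hS
  have hSc : Continuous S := continuous_measureReal_Ici hf hf0 hμ
  have hfi := integrable_of_law hf hf0 hμ
  have hSpos : ∀ s ≤ t, 0 < S s := fun s hs => hpos.trans_le (measureReal_mono (Ici_subset_Ici.2 hs))
  have hdens : ∫ x in Iic t, (S x)⁻¹ ∂μ = ∫ x in Iic t, f x * (S x)⁻¹ := by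
    rw [← integral_indicator measurableSet_Iic, ← integral_indicator measurableSet_Iic]
    conv_lhs => rw [hμ]
    rw [integral_withDensity_eq_integral_toReal_smul hf.ennreal_ofReal
      (ae_of_all _ fun x => ENNReal.ofReal_lt_top)]
    refine integral_congr_ae (ae_of_all _ fun x => ?_)
    by_cases hx : x ∈ Iic t
    · simp only [indicator_of_mem hx, ENNReal.toReal_ofReal (hf0 x), smul_eq_mul]
    · simp only [indicator_of_notMem hx, smul_zero]
  have hrestr : ∫ x in Iic t, f x * (S x)⁻¹ = ∫ x in 0..t, f x * (S x)⁻¹ := by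
    rw [intervalIntegral.integral_of_le ht0, ← integral_Icc_eq_integral_Ioc]
    refine setIntegral_eq_of_subset_of_forall_sdiff_eq_zero measurableSet_Iic
      (fun x hx => hx.2) fun x hx => ?_
    have : x < 0 := by
      by_contra h
      exact hx.2 ⟨not_lt.1 h, hx.1⟩
    rw [hfneg x this, zero_mul]
  have hSt : ∀ s, S s = 1 - ∫ x in 0..s, f x := fun s => by
    rw [← measureReal_Ici_zero hf hf0 hfneg hμ]
    exact measureReal_Ici_eq_sub hf hf0 hμ s
  rw [hdens, hrestr, intervalIntegral.integral_eq_sub_of_hasDerivAt_of_le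
    (f := fun s => -Real.log (S s)) ht0 ?_ ?_ ?_]
  · have : S 0 = 1 := measureReal_Ici_zero hf hf0 hfneg hμ
    simp only [this, Real.log_one, neg_zero, sub_zero]
    rfl
  · exact (hSc.continuousOn.log fun s hs => (hSpos s hs.2).ne').neg
  · intro s hs
    have h1 : HasDerivAt S (-f s) s := by
      have := (hasDerivAt_primitive hfi hfc ⟨hs.1, hs.2.trans htτ⟩).const_sub 1
      exact this.congr_of_eventuallyEq (Eventually.of_forall hSt)
    have h2 := (h1.log (hSpos s hs.2.le).ne').neg
    rw [neg_div, neg_neg, div_eq_mul_inv] at h2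
    exact h2
  · refine hfi.intervalIntegrable.mul_continuousOn (hSc.continuousOn.inv₀ fun s hs => ?_)
    rw [uIcc_of_le ht0] at hs
    exact (hSpos s hs.2).ne'

end Density

section Model

variable {Ω : Type*} [MeasurableSpace Ω]

theorem measureReal_le_followUp {P : Measure Ω} {X C : Ω → ℝ} (hX : Measurable X) (hC : Measurable C)
    (h : IndepFun X C P) (s : ℝ) :
    P.real {ω | s ≤ followUp (X ω) (C ω)} = (P.map X).real (Ici s) * (P.map C).real (Ici s) := by
  have h1 : {ω | s ≤ followUp (X ω) (C ω)} = X ⁻¹' Ici s ∩ C ⁻¹' Ici s := by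
    ext ω; simp [followUp]
  rw [h1, map_measureReal_apply hX measurableSet_Ici, map_measureReal_apply hC measurableSet_Ici]
  simp only [measureReal_def]
  rw [h.measure_inter_preimage_eq_mul _ _ measurableSet_Ici measurableSet_Ici, ENNReal.toReal_mul]

variable {P : Measure Ω} [IsProbabilityMeasure P]

/-- Weighting the uncensored survival times by the inverse of the at-risk probability removes the
effect of censoring from the mean. -/
theorem integral_inverse_weight {X C : Ω → ℝ} (hX : Measurable X) (hC : Measurable C)
    (h : IndepFun X C P) {t : ℝ}
    (hXc : Continuous fun s => (P.map X).real (Ici s)) (hCc : Continuous fun s => (P.map C).real (Ici s))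
    (hXt : 0 < (P.map X).real (Ici t)) (hCt : 0 < (P.map C).real (Ici t)) :
    ∫ ω, (if X ω ≤ C ω ∧ X ω ≤ t then
        ((P.map X).real (Ici (X ω)) * (P.map C).real (Ici (X ω)))⁻¹ else 0) ∂P
      = ∫ x in Iic t, ((P.map X).real (Ici x))⁻¹ ∂(P.map X) := by
  have : IsProbabilityMeasure (P.map X) := Measure.isProbabilityMeasure_map hX.aemeasurable
  have : IsProbabilityMeasure (P.map C) := Measure.isProbabilityMeasure_map hC.aemeasurable
  set Sx : ℝ → ℝ := fun s => (P.map X).real (Ici s) with hSx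
  set Sc : ℝ → ℝ := fun s => (P.map C).real (Ici s) with hSc
  have hSxt : ∀ s ≤ t, Sx t ≤ Sx s := fun s hs => measureReal_mono (Ici_subset_Ici.2 hs)
  have hSct : ∀ s ≤ t, Sc t ≤ Sc s := fun s hs => measureReal_mono (Ici_subset_Ici.2 hs)
  set φ : ℝ × ℝ → ℝ := fun z => if z.1 ≤ z.2 ∧ z.1 ≤ t then (Sx z.1 * Sc z.1)⁻¹ else 0 with hφ
  have hφm : Measurable φ := by
    refine Measurable.ite ?_ ?_ measurable_const
    · exact (measurableSet_le measurable_fst measurable_snd).inter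
        (measurableSet_le measurable_fst measurable_const)
    · exact ((hXc.measurable.comp measurable_fst).mul (hCc.measurable.comp measurable_fst)).inv
  have hφb : ∀ z, φ z ∈ Icc 0 (Sx t * Sc t)⁻¹ := by
    intro z
    simp only [hφ]
    split_ifs with hz
    · have h1 := hSxt _ hz.2
      have h2 := hSct _ hz.2
      refine ⟨inv_nonneg.2 (mul_nonneg measureReal_nonneg measureReal_nonneg), ?_⟩
      exact inv_anti₀ (mul_pos hXt hCt) (mul_le_mul h1 h2 hCt.le (hXt.le.trans h1))
    · exact ⟨le_rfl, inv_nonneg.2 (mul_pos hXt hCt).le⟩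
  have hjoint : P.map (fun ω => (X ω, C ω)) = (P.map X).prod (P.map C) :=
    (indepFun_iff_map_prod_eq_prod_map_map hX.aemeasurable hC.aemeasurable).1 h
  calc _ = ∫ ω, φ (X ω, C ω) ∂P := rfl
    _ = ∫ z, φ z ∂((P.map X).prod (P.map C)) := by
      rw [← hjoint, integral_map (hX.prodMk hC).aemeasurable hφm.aestronglyMeasurable]
    _ = ∫ x, ∫ c, φ (x, c) ∂(P.map C) ∂(P.map X) :=
      integral_prod _ (Integrable.of_mem_Icc _ _ hφm.aemeasurable (ae_of_all _ hφb))
    _ = ∫ x, (Iic t).indicator (fun x => (Sx x)⁻¹) x ∂(P.map X) := by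
      refine integral_congr_ae (ae_of_all _ fun x => ?_)
      by_cases hx : x ≤ t
      · have e : (fun c => φ (x, c)) = (Ici x).indicator fun _ => (Sx x * Sc x)⁻¹ := by
          ext c
          by_cases hc : x ≤ c <;> simp [hφ, hx, hc]
        have hpos : 0 < Sc x := hCt.trans_le (hSct x hx)
        simp only [indicator_of_mem (mem_Iic.2 hx)]
        rw [e, integral_indicator measurableSet_Ici, setIntegral_const, smul_eq_mul, mul_inv,
          mul_left_comm]
        rw [show (P.map C).real (Ici x) = Sc x from rfl, mul_inv_cancel₀ hpos.ne', mul_one]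
      · have e : (fun c => φ (x, c)) = fun _ => 0 := by
          ext c; simp [hφ, hx]
        simp only [indicator_of_notMem (fun h => hx (mem_Iic.1 h)), e, integral_zero]
    _ = _ := integral_indicator measurableSet_Iic

variable {X C : ℕ → Ω → ℝ} {f g : ℝ → ℝ}

/-- Uniform convergence of the Kaplan–Meier estimator on `[0, M']`, strictly inside the support of
the follow-up times, at any rate slower than `n ^ (-1/2)` by a power of `n`. -/
theorem tendsto_measure_kaplanMeier_deviation
    (hX : ∀ i, Measurable (X i)) (hC : ∀ i, Measurable (C i))
    (hf : Measurable f) (hf_nonneg : ∀ x, 0 ≤ f x) (hf_neg : ∀ x < 0, f x = 0)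
    (hg : Measurable g) (hg_nonneg : ∀ x, 0 ≤ g x)
    (hX_law : ∀ i, P.map (X i) = volume.withDensity fun x => ENNReal.ofReal (f x))
    (hC_law : ∀ i, P.map (C i) = volume.withDensity fun x => ENNReal.ofReal (g x))
    (h_indep : iIndepFun (fun i ω => (X i ω, C i ω)) P)
    (h_cens : ∀ i, IndepFun (X i) (C i) P)
    {τ M' : ℝ} (hfc : ContinuousOn f (Ico 0 τ)) (hM'0 : 0 ≤ M') (hM' : M' < τ)
    (hXM : 0 < (P.map (X 0)).real (Ici M')) (hCM : 0 < (P.map (C 0)).real (Ici M'))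
    {α κ : ℝ} (hα : α < 1 / 2) (hκ : 0 < κ) {r : ℕ → ℝ}
    (hr : ∀ᶠ n : ℕ in atTop, κ * (n : ℝ) ^ (-α) ≤ r n) (hr0 : Tendsto r atTop (𝓝 0)) :
    Tendsto (fun n : ℕ => P {ω | ¬ ∀ t ∈ Icc 0 M',
      |kaplanMeier (fun i : Fin n => followUp (X i ω) (C i ω))
        (fun i : Fin n => censInd (X i ω) (C i ω)) t - ∫ u in 0..t, f u| ≤ r n})
      atTop (𝓝 0) := by
  have hPX : IsProbabilityMeasure (P.map (X 0)) :=
    Measure.isProbabilityMeasure_map (hX 0).aemeasurable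
  have hPC : IsProbabilityMeasure (P.map (C 0)) :=
    Measure.isProbabilityMeasure_map (hC 0).aemeasurable
  have hXlaw : ∀ i, P.map (X i) = P.map (X 0) := fun i => (hX_law i).trans (hX_law 0).symm
  have hClaw : ∀ i, P.map (C i) = P.map (C 0) := fun i => (hC_law i).trans (hC_law 0).symm
  set Sx : ℝ → ℝ := fun s => (P.map (X 0)).real (Ici s) with hSx
  set Sc : ℝ → ℝ := fun s => (P.map (C 0)).real (Ici s) with hSc
  have hSxc : Continuous Sx := continuous_measureReal_Ici hf hf_nonneg (hX_law 0)
  have hScc : Continuous Sc := continuous_measureReal_Ici hg hg_nonneg (hC_law 0)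
  have hSxM : ∀ s ≤ M', Sx M' ≤ Sx s := fun s hs => measureReal_mono (Ici_subset_Ici.2 hs)
  have hScM : ∀ s ≤ M', Sc M' ≤ Sc s := fun s hs => measureReal_mono (Ici_subset_Ici.2 hs)
  set p := Sx M' * Sc M' with hpdef
  have hp : 0 < p := mul_pos hXM hCM
  set Hb : ℝ → ℝ := fun s => Sx s * Sc s with hHb
  have hHbc : Continuous Hb := hSxc.mul hScc
  have hHp : ∀ s ≤ M', p ≤ Hb s := fun s hs =>
    mul_le_mul (hSxM s hs) (hScM s hs) hCM.le (hXM.le.trans (hSxM s hs))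
  have hH1 : ∀ s, Hb s ≤ 1 := fun s =>
    mul_le_one₀ measureReal_le_one measureReal_nonneg measureReal_le_one
  have hSx1 : ∀ t, Sx t = 1 - ∫ u in 0..t, f u := fun t => by
    rw [← measureReal_Ici_zero hf hf_nonneg hf_neg (hX_law 0)]
    exact measureReal_Ici_eq_sub hf hf_nonneg (hX_law 0) t
  set A : ℝ → ℝ := fun t => -Real.log (Sx t) with hA
  have hAc : ContinuousOn A (Icc 0 M') :=
    (hSxc.continuousOn.log fun s hs => (hXM.trans_le (hSxM s hs.2)).ne').neg
  have hA0 : A 0 = 0 := by simp [hA, hSx1]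
  have hAnn : ∀ t ∈ Icc 0 M', 0 ≤ A t := fun t _ =>
    neg_nonneg.2 (Real.log_nonpos measureReal_nonneg measureReal_le_one)
  set L := 1 + 10 / p ^ 2 with hL
  have hL0 : 0 < L := by positivity
  set ρ : ℕ → ℝ := fun n => r n / L with hρ
  have hρr : ∀ᶠ n : ℕ in atTop, κ / L * (n : ℝ) ^ (-α) ≤ ρ n := by
    filter_upwards [hr] with n hn
    rw [hρ, div_mul_eq_mul_div]
    exact div_le_div_of_nonneg_right hn hL0.le
  have hρp : ∀ᶠ n : ℕ in atTop, ρ n ≤ p / 2 := by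
    have h1 : Tendsto ρ atTop (𝓝 0) := by simpa using hr0.div_const L
    exact (h1.eventually_lt_const (by positivity : (0 : ℝ) < p / 2)).mono fun _ h => h.le
  -- the two monotone empirical processes
  set Y₁ : ℕ → ℝ → Ω → ℝ := fun i s ω => if followUp (X i ω) (C i ω) < s then 1 else 0 with hY₁
  set Y₂ : ℕ → ℝ → Ω → ℝ := fun i t ω =>
    if X i ω ≤ C i ω ∧ X i ω ≤ t then (Hb (X i ω))⁻¹ else 0 with hY₂
  have hTm : ∀ i, Measurable fun ω => followUp (X i ω) (C i ω) := fun i => (hX i).min (hC i)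
  have hdev₁ := tendsto_measure_uniform_deviation (P := P) (Y := Y₁) (A := fun s => 1 - Hb s)
    (a := 0) (b := M') (B := 1) hM'0 one_pos
    (fun i s _ => Measurable.ite (measurableSet_lt (hTm i) measurable_const) measurable_const
      measurable_const)
    (fun s _ => h_indep.comp (fun _ z => if followUp z.1 z.2 < s then (1 : ℝ) else 0) fun _ =>
      Measurable.ite (measurableSet_lt (measurable_fst.min measurable_snd) measurable_const)
        measurable_const measurable_const)
    (fun i s _ ω => by simp only [hY₁]; split_ifs <;> simp)
    (fun i ω s _ t _ hst => by
      simp only [hY₁]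
      split_ifs with h1 h2
      · exact le_rfl
      · exact absurd (h1.trans_le hst) h2
      · exact zero_le_one
      · exact le_rfl)
    (fun i s _ => by
      have hset : MeasurableSet {ω | s ≤ followUp (X i ω) (C i ω)} :=
        measurableSet_le measurable_const (hTm i)
      have e : Y₁ i s = {ω | s ≤ followUp (X i ω) (C i ω)}ᶜ.indicator fun _ => (1 : ℝ) := by
        ext ω
        simp only [hY₁, indicator, mem_compl_iff, mem_ofPred_eq, not_le]
      rw [e, integral_indicator hset.compl, setIntegral_const, smul_eq_mul, mul_one,
        probReal_compl_eq_one_sub hset, measureReal_le_followUp (hX i) (hC i) (h_cens i),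
        hXlaw, hClaw])
    (continuous_const.sub hHbc).continuousOn hα (div_pos hκ hL0) hρr
  have hdev₂ := tendsto_measure_uniform_deviation (P := P) (Y := Y₂) (A := A)
    (a := 0) (b := M') (B := p⁻¹) hM'0 (inv_pos.2 hp)
    (fun i t _ => Measurable.ite ((measurableSet_le (hX i) (hC i)).inter
      (measurableSet_le (hX i) measurable_const)) (hHbc.measurable.comp (hX i)).inv measurable_const)
    (fun t _ => h_indep.comp (fun _ z => if z.1 ≤ z.2 ∧ z.1 ≤ t then (Hb z.1)⁻¹ else 0) fun _ =>
      Measurable.ite ((measurableSet_le measurable_fst measurable_snd).inter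
        (measurableSet_le measurable_fst measurable_const))
        (hHbc.measurable.comp measurable_fst).inv measurable_const)
    (fun i t ht ω => by
      simp only [hY₂]
      split_ifs with h1
      · have h2 := hHp _ (h1.2.trans ht.2)
        exact ⟨inv_nonneg.2 (hp.le.trans h2), inv_anti₀ hp h2⟩
      · exact ⟨le_rfl, (inv_pos.2 hp).le⟩)
    (fun i ω s _ t ht hst => by
      simp only [hY₂]
      split_ifs with h1 h2 h2
      · exact le_rfl
      · exact absurd ⟨h1.1, h1.2.trans hst⟩ h2
      · exact inv_nonneg.2 (hp.le.trans (hHp _ (h2.2.trans ht.2)))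
      · exact le_rfl)
    (fun i t ht => by
      have hXt : 0 < Sx t := hXM.trans_le (hSxM t ht.2)
      have h1 := integral_inverse_weight (hX i) (hC i) (h_cens i) (t := t)
        (by rw [hXlaw]; exact hSxc) (by rw [hClaw]; exact hScc) (by rw [hXlaw]; exact hXt)
        (by rw [hClaw]; exact hCM.trans_le (hScM t ht.2))
      simp only [hXlaw, hClaw] at h1
      exact h1.trans (setIntegral_Iic_inv_survival hf hf_nonneg hf_neg (hX_law 0) hfc ht.1
        (ht.2.trans_lt hM') hXt))
    hAc hα (div_pos hκ hL0) hρr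
  -- uncensored follow-up times lie in `[0, ∞)`, the range controlled by the two deviations
  have hXpos : ∀ᵐ ω ∂P, ∀ i, 0 ≤ X i ω := by
    refine ae_all_iff.2 fun i => ?_
    have h1 : (P.map (X i)).real (Ici 0) = 1 := by
      rw [hXlaw]; exact measureReal_Ici_zero hf hf_nonneg hf_neg (hX_law 0)
    rw [map_measureReal_apply (hX i) measurableSet_Ici] at h1
    have h2 := probReal_compl_eq_one_sub (μ := P) (hX i (measurableSet_Ici (a := (0 : ℝ))))
    rw [h1, sub_self, measureReal_eq_zero_iff] at h2
    exact mem_ae_iff.2 h2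
  have hsum := hdev₁.add hdev₂
  rw [add_zero] at hsum
  refine tendsto_of_tendsto_of_tendsto_of_le_of_le' tendsto_const_nhds hsum
    (Eventually.of_forall fun _ => zero_le) ?_
  filter_upwards [hρp, eventually_gt_atTop 0] with n hn hn0
  refine le_trans (measure_mono_ae ?_) (measure_union_le _ _)
  filter_upwards [hXpos] with ω hω hbad
  by_contra hcon
  obtain ⟨h1, h2⟩ := not_or.1 (mt (mem_union ω _ _).2 hcon)
  rw [mem_ofPred_eq, not_not] at h1 h2
  have hn' : (n : ℝ) ≠ 0 := by exact_mod_cast hn0.ne'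
  refine hbad fun t ht => ?_
  have hcens : ∀ i, censInd (X i ω) (C i ω) = 1 ↔ X i ω ≤ C i ω := fun i => by
    unfold censInd; split_ifs with h <;> simp [h]
  have hkm := abs_kaplanMeier_sub_le (fun i : Fin n => followUp (X i ω) (C i ω))
    (fun i : Fin n => censInd (X i ω) (C i ω)) hn0 (M := M') (ρ := ρ n) (p := p) (Hb := Hb)
    (A := A) hp hn
    (fun i hi => by
      rw [hcens] at hi
      rw [followUp, min_eq_left hi]
      exact hω i)
    (fun s hs => hHp s hs.2) (fun s _ => hH1 s) hA0 hAnn hAc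
    (fun s hs => by
      have e : (atRisk (fun i : Fin n => followUp (X i ω) (C i ω)) s : ℝ) / n
          = 1 - (∑ i ∈ Finset.range n, Y₁ i s ω) / n := by
        rw [Finset.sum_range, eq_sub_iff_add_eq, ← add_div, div_eq_one_iff_eq hn', atRisk,
          Finset.card_filter, Nat.cast_sum, ← Finset.sum_add_distrib]
        calc _ = ∑ _i : Fin n, (1 : ℝ) := Finset.sum_congr rfl fun i _ => by
              by_cases h : s ≤ followUp (X i ω) (C i ω)
              · simp [hY₁, h, h.not_gt]
              · simp [hY₁, h, not_le.1 h]
          _ = n := by simp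
      rw [e, ← abs_neg]
      convert h1 s hs using 2
      ring)
    (fun s hs => by
      convert h2 s hs using 4
      rw [Finset.sum_range]
      refine Finset.sum_congr rfl fun i _ => ?_
      simp only [hcens, hY₂]
      by_cases h : X i ω ≤ C i ω
      · simp [followUp, h]
      · simp [h])
    ht
  have hexp : 1 - Real.exp (-A t) = ∫ u in 0..t, f u := by
    rw [hA, neg_neg, Real.exp_log (hXM.trans_le (hSxM t ht.2)), hSx1]; ring
  rwa [hexp, hρ, mul_div_cancel₀ _ hL0.ne'] at hkm

end Model

end SmoothedGrenander

/-! ### Uniform consistency -/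

theorem mainTheorem5
    {Ω : Type*} [MeasurableSpace Ω] (P : Measure Ω) [IsProbabilityMeasure P]
    -- survival times `X i` and censoring times `C i`, with densities `f` and `g`
    (X C : ℕ → Ω → ℝ) (f g : ℝ → ℝ)
    (hX : ∀ i, Measurable (X i)) (hC : ∀ i, Measurable (C i))
    (hf : Measurable f) (hf_nonneg : ∀ x, 0 ≤ f x) (hf_neg : ∀ x < 0, f x = 0)
    (hg : Measurable g) (hg_nonneg : ∀ x, 0 ≤ g x)
    (hX_law : ∀ i, P.map (X i) = volume.withDensity fun x => ENNReal.ofReal (f x))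
    (hC_law : ∀ i, P.map (C i) = volume.withDensity fun x => ENNReal.ofReal (g x))
    -- random censorship: independent pairs, with independent components
    (h_indep : iIndepFun (fun i ω => (X i ω, C i ω)) P)
    (h_cens : ∀ i, IndepFun (X i) (C i) P)
    -- the end points of the supports of `H`, `G` and `F`
    (τ : ℝ)
    (hτH : SmoothedGrenander.rightEndpoint
      (P.map fun ω => SmoothedGrenander.followUp (X 0 ω) (C 0 ω)) = (τ : EReal))
    (hτG : SmoothedGrenander.rightEndpoint (P.map (C 0)) = (τ : EReal))
    (hτF : (τ : EReal) < SmoothedGrenander.rightEndpoint (P.map (X 0)))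
    -- shape and smoothness of the density
    (hf_mono : MonotoneOn f (Ico 0 τ)) (hf_unif : UniformContinuousOn f (Ico 0 τ))
    -- the kernel
    (k : ℝ → ℝ) (hk : SmoothedGrenander.IsStandardKernel k)
    (hk_diff : Differentiable ℝ k) (hk_deriv : ∃ K : ℝ, ∀ u, |deriv k u| ≤ K)
    -- the bandwidth
    (b : ℕ → ℝ) (α c : ℝ) (hα_pos : 0 < α) (hα_lt : α < 1 / 2) (hc : 0 < c)
    (hb : Tendsto (fun n : ℕ => b n * (n : ℝ) ^ α) atTop (𝓝 c))
    (M : ℝ) (hM_pos : 0 < M) (hM_lt : M < τ) :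
    ∀ ε : ℝ, 0 < ε →
      Tendsto
        (fun n : ℕ => P {ω | ENNReal.ofReal ε ≤ ⨆ x ∈ Icc (0 : ℝ) M, ENNReal.ofReal
          |SmoothedGrenander.smoothedGrenander k τ (b n)
              (fun i : Fin n => SmoothedGrenander.followUp (X i ω) (C i ω))
              (fun i : Fin n => SmoothedGrenander.censInd (X i ω) (C i ω)) x - f x|})
        atTop (𝓝 0) := by
  open SmoothedGrenander in
  intro ε hε
  have hPX : IsProbabilityMeasure (P.map (X 0)) :=
    Measure.isProbabilityMeasure_map (hX 0).aemeasurable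
  have hPC : IsProbabilityMeasure (P.map (C 0)) :=
    Measure.isProbabilityMeasure_map (hC 0).aemeasurable
  have hkc : Continuous k := hk_diff.continuous
  have hfc : ContinuousOn f (Ico 0 τ) := hf_unif.continuousOn
  have hfi : Integrable f := integrable_of_law hf hf_nonneg (hX_law 0)
  obtain ⟨K, hK0, hK⟩ := hk.exists_abs_boundaryKernel_le hkc
  obtain ⟨M₁, hMM₁, hM₁τ⟩ := exists_between hM_lt
  have hM₁0 : 0 < M₁ := hM_pos.trans hMM₁
  -- the final error is at most `K (2 · 4e + B γ)`; the choices of `e` and `γ` make each term `ε / 4`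
  set e := ε / (32 * K) with he
  have he0 : 0 < e := by positivity
  set B := f M₁ + 3 * e with hB
  have hB0 : 0 < B := by have := hf_nonneg M₁; positivity
  set γ := ε / (4 * K * B) with hγ
  have hγ0 : 0 < γ := by positivity
  obtain ⟨δ₀, hδ₀, hmod₀⟩ := Metric.uniformContinuousOn_iff_le.1 hf_unif e he0
  set δ := min δ₀ ((τ - M₁) / 2) with hδ
  have hδ0 : 0 < δ := lt_min hδ₀ (by linarith)
  have hδτ : M₁ + δ < τ := by linarith [min_le_right δ₀ ((τ - M₁) / 2)]
  have hmod : ∀ x ∈ Ico 0 τ, ∀ y ∈ Ico 0 τ, |x - y| ≤ δ → |f x - f y| ≤ e :=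
    fun x hx y hy h => hmod₀ x hx y hy (h.trans (min_le_left _ _))
  obtain ⟨M', hM'1, hM'τ, htail⟩ : ∃ M', M₁ + δ ≤ M' ∧ M' < τ ∧ ∫ u in M'..τ, f u ≤ e * δ / 3 := by
    have hc1 : Continuous fun m => ∫ u in m..τ, f u := by
      simp_rw [fun m => intervalIntegral.integral_symm (f := f) (μ := volume) τ m]
      exact (intervalIntegral.continuous_primitive (fun _ _ => hfi.intervalIntegrable) τ).neg
    have hlim : Tendsto (fun m => ∫ u in m..τ, f u) (𝓝[<] τ) (𝓝 0) := by
      have := hc1.tendsto τ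
      rw [intervalIntegral.integral_same] at this
      exact this.mono_left nhdsWithin_le_nhds
    obtain ⟨m, h1, h2⟩ := ((hlim.eventually_lt_const (by positivity : 0 < e * δ / 3)).and
      (Ioo_mem_nhdsLT hδτ)).exists
    exact ⟨m, h2.1.le, h2.2, h1.le⟩
  set θ := e * γ / 2 with hθ
  have hθ0 : 0 < θ := by positivity
  have hb_lower : ∀ᶠ n : ℕ in atTop, c / 2 * (n : ℝ) ^ (-α) ≤ b n ∧ 0 < b n := by
    filter_upwards [hb.eventually_const_lt (half_lt_self hc), eventually_gt_atTop 0] with n hn hn0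
    have hpow : 0 < (n : ℝ) ^ (-α) := Real.rpow_pos_of_pos (by exact_mod_cast hn0) _
    have h1 : b n * (n : ℝ) ^ α * (n : ℝ) ^ (-α) = b n := by
      rw [mul_assoc, ← Real.rpow_add (by exact_mod_cast hn0), add_neg_cancel, Real.rpow_zero,
        mul_one]
    have h2 := mul_lt_mul_of_pos_right hn hpow
    rw [h1] at h2
    exact ⟨h2.le, lt_trans (by positivity) h2⟩
  have hb0 : Tendsto b atTop (𝓝 0) := by
    have h1 := hb.mul ((tendsto_rpow_neg_atTop hα_pos).comp tendsto_natCast_atTop_atTop)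
    rw [mul_zero] at h1
    refine h1.congr' ?_
    filter_upwards [eventually_gt_atTop 0] with n hn0
    simp only [Function.comp_apply]
    rw [mul_assoc, ← Real.rpow_add (by exact_mod_cast hn0), add_neg_cancel, Real.rpow_zero, mul_one]
  have hdev := tendsto_measure_kaplanMeier_deviation (r := fun n => θ * b n) hX hC hf hf_nonneg
    hf_neg hg hg_nonneg hX_law hC_law h_indep h_cens hfc (by linarith : 0 ≤ M') hM'τ
    (measureReal_Ici_pos_of_lt_rightEndpoint ((EReal.coe_lt_coe_iff.2 hM'τ).trans hτF))
    (measureReal_Ici_pos_of_lt_rightEndpoint (hτG ▸ EReal.coe_lt_coe_iff.2 hM'τ))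
    hα_lt (by positivity : 0 < θ * (c / 2))
    (hb_lower.mono fun n hn => by rw [mul_assoc]; exact mul_le_mul_of_nonneg_left hn.1 hθ0.le)
    (by simpa using hb0.const_mul θ)
  have hb_small : ∀ᶠ n in atTop, b n < δ ∧ b n < M₁ - M ∧ θ * b n < e * δ / 3 := by
    have h1 : Tendsto (fun n => θ * b n) atTop (𝓝 0) := by simpa using hb0.const_mul θ
    exact (hb0.eventually_lt_const hδ0).and ((hb0.eventually_lt_const (by linarith)).and
      (h1.eventually_lt_const (by positivity)))
  refine tendsto_of_tendsto_of_tendsto_of_le_of_le' tendsto_const_nhds hdev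
    (Eventually.of_forall fun _ => zero_le) ?_
  filter_upwards [hb_lower, hb_small] with n hn hn'
  obtain ⟨hbδ, hbM, hbθ⟩ := hn'
  have hbn : 0 < b n := hn.2
  refine measure_mono fun ω hω hgood => ?_
  refine absurd (mem_ofPred_eq ▸ hω) (not_le.2 ?_)
  refine lt_of_le_of_lt (iSup₂_le fun x hx => ENNReal.ofReal_le_ofReal (q := ε / 2) ?_)
    ((ENNReal.ofReal_lt_ofReal_iff hε).2 (half_lt_self hε))
  have hxτ : x ∈ Ico 0 τ := ⟨hx.1, by linarith [hx.2]⟩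
  have hslope : ∀ u, 0 < u → |u - x| ≤ b n → _ := fun u hu hux =>
    leftDeriv_gcm_bounds (M₁ := M₁) (s₀ := γ * b n) hfi hf_nonneg hf_mono hfc he0 hδ0 hM'1 hM'τ
      hmod (kaplanMeier_monotone _ _) htail hbθ.le (by rw [hθ]; linarith) hgood hu
      (by linarith [(abs_le.1 hux).2, hx.2])
  have huτ : ∀ u, 0 < u → |u - x| ≤ b n → u ∈ Ico 0 τ := fun u hu hux =>
    ⟨hu.le, by linarith [(abs_le.1 hux).2, hx.2]⟩
  have hfu : ∀ u, 0 < u → |u - x| ≤ b n → |f u - f x| ≤ e := fun u hu hux =>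
    hmod u (huτ u hu hux) x hxτ (hux.trans hbδ.le)
  have hfx : f x ≤ f M₁ := hf_mono hxτ ⟨hM₁0.le, hM₁τ⟩ (by linarith [hx.2])
  have hmain := abs_kernel_average_sub_le (v := f x) (E := 4 * e) (B := B) (s₀ := γ * b n) hk hkc hbn
    hx.1 (by linarith [hx.2]) (fun u => hK τ (b n) x u hbn hx.1 (by linarith [hx.2]))
    (monotoneOn_grenander (fun i : Fin n => followUp (X i ω) (C i ω))
      (fun i : Fin n => censInd (X i ω) (C i ω)) τ) (by positivity) hB0.le (by positivity)
    (fun u hu hux => by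
      obtain ⟨h1, h2, -⟩ := hslope u hu hux
      have h3 := (abs_le.1 (hfu u hu hux)).2
      have h4 := hf_nonneg x
      have h5 := hf_nonneg M₁
      rw [abs_le, grenander]
      constructor <;> linarith)
    (fun u hus hu hux => by
      obtain ⟨-, h2, h3⟩ := hslope u hu hux
      have h3 := h3 hus
      have h4 := abs_le.1 (hfu u hu hux)
      rw [abs_le, grenander]
      constructor <;> linarith [h4.1, h4.2])
  refine hmain.trans_eq ?_
  rw [mul_div_assoc, mul_div_assoc, div_self hbn.ne', mul_one, hγ, he]
  field_simp
  ring
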